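/- Let $X$ be a Banach space (real or complex) that is not super-reflexive, i.e. there is a non-reflexive Banach space $Y$ over the same field that is finitely representable in $X$ (for every $\eta>0$, every finite-dimensional subspace $F\subseteq Y$ admits a linear map $S\colon F\to X$ with $\|y\|\le\|Sy\|\le(1+\eta)\|y\|$ for all $y\in F$). Let $\mathcal L_0$ be the graph consisting of two vertices joined by an edge, and for $n\ge1$ let the Laakso graph $\mathcal L_n$ be obtained from $\mathcal L_{n-1}$ by replacing each edge $pq$ with four new vertices $T,L,R,B$ and the six edges $pT$, $TL$, $TR$, $LB$, $RB$, $Bq$. Let $d$ be the shortest-path metric on the vertex set of $\mathcal L_n$, each edge having length $1$. Then for every $n\ge1$ and every $\varepsilon>0$ there is a map $f_n\colon\mathcal L_n\to X$ such that $$\tfrac12\, d(a,b)-\varepsilon\;\le\;\|f_n(a)-f_n(b)\|\;\le\; d(a,b)\qquad\text{for all } a,b\in\mathcal L_n,$$ and such that, moreover, $f_n$ is bilipschitz with distortion less than $2+\varepsilon$, where the distortion of $f_n$ is the infimum of $\beta/\alpha$ over all $\alpha,\beta>0$ with $\alpha\, d(a,b)\le\|f_n(a)-f_n(b)\|\le\beta\,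 d(a,b)$ for all $a,b\in\mathcal L_n$. -/

import Mathlib

universe u v w

/-! ### Super-reflexivity -/

/-- A normed space is reflexive if the canonical map into its bidual is onto. -/
def IsReflexiveSpace (𝕜 : Type w) [RCLike 𝕜] (Y : Type v)
    [NormedAddCommGroup Y] [NormedSpace 𝕜 Y] : Prop :=
  Function.Surjective (NormedSpace.inclusionInDoubleDual 𝕜 Y)

/-- `Y` is finitely representable in `X`: for every `ε > 0`, every finite-dimensional subspace of
`Y` is `(1 + ε)`-isomorphic to a subspace of `X`. (The operator is normalised so that its inverse
has norm at most one.) -/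
def IsFinitelyRepresentable (𝕜 : Type w) [RCLike 𝕜]
    (Y : Type v) [NormedAddCommGroup Y] [NormedSpace 𝕜 Y]
    (X : Type u) [NormedAddCommGroup X] [NormedSpace 𝕜 X] : Prop :=
  ∀ F : Submodule 𝕜 Y, FiniteDimensional 𝕜 F → ∀ ε : ℝ, 0 < ε →
    ∃ S : F →ₗ[𝕜] X, ∀ y : F, ‖y‖ ≤ ‖S y‖ ∧ ‖S y‖ ≤ (1 + ε) * ‖y‖

/-- `X` is super-reflexive if every Banach space `Y` (over the same field) which is finitely
representable in `X` is reflexive. The universe `v` of the spaces `Y` is arbitrary. -/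
def IsSuperReflexive (𝕜 : Type w) [RCLike 𝕜]
    (X : Type u) [NormedAddCommGroup X] [NormedSpace 𝕜 X] : Prop :=
  ∀ (Y : Type v) [NormedAddCommGroup Y] [NormedSpace 𝕜 Y] [CompleteSpace Y],
    IsFinitelyRepresentable 𝕜 Y X → IsReflexiveSpace 𝕜 Y

/-! ### The Laakso graphs -/

/-- A graph given by its vertices and its edges, each edge being listed with an orientation.
The orientation only serves to name the two ends of an edge. -/
structure EdgeGraph where
  V : Type
  E : Type
  src : E → V
  tgt : E → V

/-- The underlying simple graph. -/
def EdgeGraph.toSimpleGraph (G : EdgeGraph) : SimpleGraph G.V :=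
  SimpleGraph.fromRel fun x y => ∃ e : G.E, G.src e = x ∧ G.tgt e = y

/-- The four vertices of the Laakso graph of level one other than its two end vertices. -/
inductive LaaksoInner : Type
  | T | L | R | B

/-- The six edges of the Laakso graph of level one. -/
inductive LaaksoEdge : Type
  | Y | C | D | E | F | Z

/-- Replace each edge `pq` by a copy of the Laakso graph of level one, that is, by four new vertices
`T, L, R, B` and the six edges `pT, TL, TR, LB, RB, Bq`. -/
def EdgeGraph.replaceEdges (G : EdgeGraph) : EdgeGraph where
  V := G.V ⊕ (G.E × LaaksoInner)
  E := G.E × LaaksoEdge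
  src := fun
    | (e, .Y) => .inl (G.src e)
    | (e, .C) => .inr (e, .T)
    | (e, .D) => .inr (e, .T)
    | (e, .E) => .inr (e, .L)
    | (e, .F) => .inr (e, .R)
    | (e, .Z) => .inr (e, .B)
  tgt := fun
    | (e, .Y) => .inr (e, .T)
    | (e, .C) => .inr (e, .L)
    | (e, .D) => .inr (e, .R)
    | (e, .E) => .inr (e, .B)
    | (e, .F) => .inr (e, .B)
    | (e, .Z) => .inl (G.tgt e)

/-- The Laakso graphs with oriented edges: level zero is a single edge (from `false` to `true`), and
level `n + 1` arises from level `n` by replacing each edge by the Laakso graph of level one. -/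
def laaksoEdgeGraph : ℕ → EdgeGraph
  | 0 => { V := Bool, E := Unit, src := fun _ => false, tgt := fun _ => true }
  | n + 1 => (laaksoEdgeGraph n).replaceEdges

/-- The vertex set of the Laakso graph of level `n`. -/
def Laakso (n : ℕ) : Type := (laaksoEdgeGraph n).V

/-- The Laakso graph of level `n`. -/
def laaksoGraph (n : ℕ) : SimpleGraph (Laakso n) := (laaksoEdgeGraph n).toSimpleGraph

theorem EdgeGraph.reachable_src_tgt (G : EdgeGraph) (e : G.E) :
    G.toSimpleGraph.Reachable (G.src e) (G.tgt e) := by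
  by_cases h : G.src e = G.tgt e
  · rw [h]
  · exact SimpleGraph.Adj.reachable ((SimpleGraph.fromRel_adj _ _ _).2 ⟨h, Or.inl ⟨e, rfl, rfl⟩⟩)

theorem EdgeGraph.replaceEdges_connected (G : EdgeGraph) (hG : G.toSimpleGraph.Connected) :
    G.replaceEdges.toSimpleGraph.Connected := by
  have key : ∀ (e : G.E) (l : LaaksoEdge), G.replaceEdges.toSimpleGraph.Reachable
      (G.replaceEdges.src (e, l)) (G.replaceEdges.tgt (e, l)) :=
    fun e l => G.replaceEdges.reachable_src_tgt (e, l)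
  have hT : ∀ e : G.E, G.replaceEdges.toSimpleGraph.Reachable
      (Sum.inl (G.src e)) (Sum.inr (e, .T)) := fun e => key e .Y
  have hL : ∀ e : G.E, G.replaceEdges.toSimpleGraph.Reachable
      (Sum.inl (G.src e)) (Sum.inr (e, .L)) := fun e => (hT e).trans (key e .C)
  have hR : ∀ e : G.E, G.replaceEdges.toSimpleGraph.Reachable
      (Sum.inl (G.src e)) (Sum.inr (e, .R)) := fun e => (hT e).trans (key e .D)
  have hB : ∀ e : G.E, G.replaceEdges.toSimpleGraph.Reachable
      (Sum.inl (G.src e)) (Sum.inr (e, .B)) := fun e => (hL e).trans (key e .E)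
  have hU : ∀ e : G.E, G.replaceEdges.toSimpleGraph.Reachable
      (Sum.inl (G.src e)) (Sum.inl (G.tgt e)) := fun e => (hB e).trans (key e .Z)
  have hinl : ∀ x y : G.V, G.replaceEdges.toSimpleGraph.Reachable (Sum.inl x) (Sum.inl y) := by
    intro x y
    obtain ⟨p⟩ := hG.preconnected x y
    induction p with
    | nil => exact SimpleGraph.Reachable.refl _
    | cons h _ ih =>
      refine SimpleGraph.Reachable.trans ?_ ih
      obtain ⟨-, ⟨e, rfl, rfl⟩ | ⟨e, rfl, rfl⟩⟩ := (SimpleGraph.fromRel_adj _ _ _).1 h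
      · exact hU e
      · exact (hU e).symm
  obtain ⟨x₀⟩ := hG.nonempty
  have hall : ∀ x : G.replaceEdges.V,
      G.replaceEdges.toSimpleGraph.Reachable (Sum.inl x₀) x := by
    rintro (x | ⟨e, _ | _ | _ | _⟩)
    · exact hinl x₀ x
    · exact (hinl _ _).trans (hT e)
    · exact (hinl _ _).trans (hL e)
    · exact (hinl _ _).trans (hR e)
    · exact (hinl _ _).trans (hB e)
  have : Nonempty G.replaceEdges.V := ⟨Sum.inl x₀⟩
  exact ⟨fun x y => (hall x).symm.trans (hall y)⟩

theorem laaksoGraph_connected (n : ℕ) : (laaksoGraph n).Connected := by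
  induction n with
  | zero =>
    have h : (laaksoEdgeGraph 0).toSimpleGraph.Reachable false true :=
      (laaksoEdgeGraph 0).reachable_src_tgt ()
    have : Nonempty (Laakso 0) := ⟨false⟩
    refine ⟨?_⟩
    rintro (_ | _) (_ | _)
    · exact SimpleGraph.Reachable.refl _
    · exact h
    · exact h.symm
    · exact SimpleGraph.Reachable.refl _
  | succ n ih => exact (laaksoEdgeGraph n).replaceEdges_connected ih

/-- The shortest-path metric of the Laakso graph, every edge having length one. -/
noncomputable instance Laakso.instMetricSpace (n : ℕ) : MetricSpace (Laakso n) where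
  dist a b := ((laaksoGraph n).dist a b : ℝ)
  dist_self a := by simp
  dist_comm a b := by rw [SimpleGraph.dist_comm]
  dist_triangle a b c := by exact_mod_cast (laaksoGraph_connected n).dist_triangle
  eq_of_dist_eq_zero {a b} h :=
    ((laaksoGraph_connected n).dist_eq_zero_iff).1 (by exact_mod_cast h)

/-! ### Bilipschitz maps and distortion -/

/-- The ratios `β / α` over all `α, β > 0` with `α ρ(x, y) ≤ σ(f x, f y) ≤ β ρ(x, y)`. -/
def distortionRatios {M : Type*} {N : Type*} [MetricSpace M] [MetricSpace N] (f : M → N) : Set ℝ :=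
  {r | ∃ α β : ℝ, 0 < α ∧ 0 < β ∧ r = β / α ∧
    ∀ x y : M, α * dist x y ≤ dist (f x) (f y) ∧ dist (f x) (f y) ≤ β * dist x y}

/-- `f` is bilipschitz. -/
def IsBilipschitz {M : Type*} {N : Type*} [MetricSpace M] [MetricSpace N] (f : M → N) : Prop :=
  (distortionRatios f).Nonempty

/-- The distortion of a bilipschitz map. -/
noncomputable def distortion {M : Type*} {N : Type*} [MetricSpace M] [MetricSpace N]
    (f : M → N) : ℝ :=
  sInf (distortionRatios f)

/-!
A space that is not super-reflexive contains, for every `N` and every `c < 1`, vectors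
`x 0, …, x (N - 1)` of the unit ball such that for every `k ≤ N` some functional of norm at most one
is at least `c` on the first `k` of them and at most `-c` on the others. The Laakso graph of level
`n` is drawn with such vectors for `N = 2 ^ n`.

**The vectors.** A non-reflexive Banach space `Y` carries bounded sequences with `g k (z j) = 1` for
`k ≤ j` and `g k (z j) = 0` for `j < k` (`exists_triangular_system`, by Helly's lemma). Consider
vectors on which consecutive blocks of the functionals `g k` take the values `1, -1, 1, …`. By
Ramsey's theorem the minimal norm of such a vector, up to a factor `1 + δ`, may be assumed to depend
only on the number of blocks. It grows at most linearly with this number, so that some additional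
block increases it by a factor of at most `1 + δ`. With that many blocks, `N` nearly minimal vectors
are chosen whose sign changes interlace. Every average of the first `k` of them and of the
negatives of the others then still alternates on one block fewer, so its norm is almost the largest
possible (`exists_flat_sequence_of_not_reflexive`). Finite representability moves the
vectors into `X`, and norming functionals of the signed sums have the required signs.

**The drawing.** The edges of the Laakso graph of level `m` are labelled by dyadic intervals of
length `2 ^ (n - m)`, and an edge is drawn as the average of `x` over its interval, times its length
`4 ^ (n - m)`. When an edge is replaced, `pT`, `TL`, `RB` receive the first half of its interval and
`TR`, `LB`, `Bq` the second half (`Drawing.refine`). Both branches from `T` to `B` have the same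
sum, and the drawing does not increase distances. For the lower estimate it is shown, by
induction on `m`, that any two edges are in one of two positions. They may be *separated*: a single
functional sees the distances between their points up to the factor `c`. This happens if the edges
lie on a common path from the bottom to the top, or on the lower parts, or on the upper parts, of
opposite branches. Or they may be *crossed*, one on the upper part of a branch and the other on the
lower part of the opposite branch, the parts having length `H`. Then both use the same half
of an interval, and some average of two functionals is almost zero on this half and almost one on
the other, so that the distance of the images is at least almost `H`. The distance in the graph is
at most `2 * H`, because the ways around through `T` and through `B` have total length `4 * H`.
-/

/-! ### Ramsey's theorem -/

/-- The value that a colouring of finite sets of naturals takes on `insert p t` for almost all `p`,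
with respect to the fixed nonprincipal ultrafilter, iterated `d` times. For finite `κ` this value
exists, and the default `f t` is not used. -/
noncomputable def ultraColour {κ : Type*} (f : Finset ℕ → κ) : ℕ → Finset ℕ → κ
  | 0, t => f t
  | d + 1, t => by
      classical
      exact if h : ∃ c, ∀ᶠ p in (Filter.hyperfilter ℕ : Filter ℕ),
        ultraColour f d (insert p t) = c then h.choose else f t

theorem eventually_ultraColour {κ : Type*} [Finite κ] (f : Finset ℕ → κ) (d : ℕ) (t : Finset ℕ) :
    ∀ᶠ p in (Filter.hyperfilter ℕ : Filter ℕ),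
      ultraColour f d (insert p t) = ultraColour f (d + 1) t := by
  have h : ∃ c, ∀ᶠ p in (Filter.hyperfilter ℕ : Filter ℕ), ultraColour f d (insert p t) = c := by
    have h1 : ∀ᶠ p in (Filter.hyperfilter ℕ : Filter ℕ), ∃ c ∈ (Set.univ : Set κ),
        ultraColour f d (insert p t) = c :=
      Filter.Eventually.of_forall fun p => ⟨_, trivial, rfl⟩
    obtain ⟨c, -, hc⟩ := (Ultrafilter.eventually_exists_mem_iff Set.finite_univ).1 h1
    exact ⟨c, hc⟩
  rw [ultraColour, dif_pos h]
  exact h.choose_spec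

/-- Ramsey's theorem, for colourings of finite sets. -/
theorem exists_strictMono_finset_colour_eq {κ : Type*} [Finite κ] (f : Finset ℕ → κ) (r : ℕ) :
    ∃ a : ℕ → ℕ, StrictMono a ∧ ∃ c, ∀ t : Finset ℕ, t.card = r → f (t.image a) = c := by
  have step : ∀ S : Finset ℕ, ∃ p, (∀ q ∈ S, q < p) ∧ ∀ t ∈ S.powerset, ∀ d ∈ Finset.range r,
      ultraColour f d (insert p t) = ultraColour f (d + 1) t := by
    intro S
    have h1 : ∀ᶠ p in (Filter.hyperfilter ℕ : Filter ℕ), ∀ q ∈ S, q < p := by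
      rw [Filter.eventually_all_finset]
      intro q _
      exact Filter.Eventually.filter_mono Nat.hyperfilter_le_atTop
        (Filter.eventually_gt_atTop q)
    have h2 : ∀ᶠ p in (Filter.hyperfilter ℕ : Filter ℕ), ∀ t ∈ S.powerset, ∀ d ∈ Finset.range r,
        ultraColour f d (insert p t) = ultraColour f (d + 1) t := by
      rw [Filter.eventually_all_finset]
      intro t _
      rw [Filter.eventually_all_finset]
      intro d _
      exact eventually_ultraColour f d t
    exact (h1.and h2).exists
  choose nxt hlt hcol using step
  let S : ℕ → Finset ℕ := fun n => Nat.rec ∅ (fun _ T => insert (nxt T) T) n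
  have hS : ∀ n, S (n + 1) = insert (nxt (S n)) (S n) := fun n => rfl
  have hSmono : Monotone S := monotone_nat_of_le_succ fun n => by
    rw [hS]; exact Finset.subset_insert _ _
  have hmem : ∀ m n, m < n → nxt (S m) ∈ S n := fun m n h =>
    hSmono (Nat.succ_le_of_lt h) (by rw [hS]; exact Finset.mem_insert_self _ _)
  have hmono : StrictMono fun n => nxt (S n) := by
    intro m n h
    exact hlt _ _ (hmem m n h)
  refine ⟨fun n => nxt (S n), hmono, ultraColour f r ∅, ?_⟩
  have key : ∀ t : Finset ℕ, ∀ d, t.card + d = r →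
      ultraColour f d (t.image fun n => nxt (S n)) = ultraColour f r ∅ := by
    intro t
    induction t using Finset.induction_on_max with
    | empty => intro d hd; simp at hd; simp [hd]
    | insert m t hm ih =>
      intro d hd
      have hmt : m ∉ t := fun h => lt_irrefl _ (hm m h)
      rw [Finset.card_insert_of_notMem hmt] at hd
      rw [Finset.image_insert, hcol (S m), ih (d + 1) (by omega)]
      · rw [Finset.mem_powerset]
        intro q hq
        obtain ⟨i, hi, rfl⟩ := Finset.mem_image.1 hq
        exact hmem i m (hm i hi)
      · rw [Finset.mem_range]; omega
  intro t ht
  exact key t 0 (by omega)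

/-- Ramsey's theorem, for colourings of increasing tuples. -/
theorem exists_strictMono_tuple_colour_eq {κ : Type*} [Finite κ] {r : ℕ} (f : (Fin r → ℕ) → κ) :
    ∃ a : ℕ → ℕ, StrictMono a ∧ ∃ c, ∀ s : Fin r → ℕ, StrictMono s → f (a ∘ s) = c := by
  classical
  obtain ⟨a, ha, c, hc⟩ := exists_strictMono_finset_colour_eq
    (fun t : Finset ℕ => if h : t.card = r then f (t.orderEmbOfFin h) else f 0) r
  refine ⟨a, ha, c, fun s hs => ?_⟩
  have h1 : (Finset.univ.image s).card = r := by
    rw [Finset.card_image_of_injective _ hs.injective, Finset.card_fin]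
  have h2 : ((Finset.univ.image s).image a).card = r := by
    rw [Finset.card_image_of_injective _ ha.injective, h1]
  have h3 := hc _ h1
  rw [dif_pos h2] at h3
  rw [← h3]
  congr 1
  exact Finset.orderEmbOfFin_unique h2 (fun x => Finset.mem_image_of_mem _
    (Finset.mem_image_of_mem _ (Finset.mem_univ x))) (ha.comp hs)

/-! ### Biorthogonal-type sequences in non-reflexive spaces -/

/-- Helly's lemma: a finite system of linear equations `f i x = c i` in a normed space has a
solution of norm at most `M + ε` if the obvious necessary condition with constant `M` holds. -/
theorem exists_norm_le_forall_apply_eq {𝕜 : Type*} [RCLike 𝕜] {E : Type*} [NormedAddCommGroup E]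
    [NormedSpace 𝕜 E] {ι : Type*} [Fintype ι] (f : ι → StrongDual 𝕜 E) (c : ι → 𝕜) {M : ℝ}
    (hM : 0 ≤ M)
    (h : ∀ a : ι → 𝕜, ‖∑ i, a i * c i‖ ≤ M * ‖∑ i, a i • f i‖) {ε : ℝ} (hε : 0 < ε) :
    ∃ x : E, ‖x‖ ≤ M + ε ∧ ∀ i, f i x = c i := by
  classical
  let T : E →ₗ[𝕜] (ι → 𝕜) := LinearMap.pi fun i => (f i : E →ₗ[𝕜] 𝕜)
  have hc : c ∈ LinearMap.range T := by
    by_contra hc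
    obtain ⟨φ, hφ, hle⟩ := Submodule.exists_le_ker_of_notMem hc
    have hexp : ∀ y : ι → 𝕜, φ y = ∑ i, φ (Pi.single i 1) * y i := by
      intro y
      conv_lhs => rw [pi_eq_sum_univ' y]
      rw [map_sum]
      refine Finset.sum_congr rfl fun i _ => ?_
      rw [map_smul, smul_eq_mul, mul_comm]
    have h0 : ∑ i, φ (Pi.single i 1) • f i = 0 := by
      ext x
      have := hle (LinearMap.mem_range_self T x)
      rw [LinearMap.mem_ker, hexp] at this
      simpa [T] using this
    have h1 := h fun i => φ (Pi.single i 1)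
    rw [h0, norm_zero, mul_zero, ← hexp] at h1
    exact hφ (norm_le_zero_iff.1 h1)
  obtain ⟨x₀, hx₀⟩ := hc
  have hx₀i : ∀ i, f i x₀ = c i := fun i => congrFun hx₀ i
  let K : Submodule 𝕜 E := LinearMap.ker T
  have hKc : IsClosed (K : Set E) := by
    have : (K : Set E) = ⋂ i, (f i) ⁻¹' {0} := by
      ext x
      simp [K, T, funext_iff]
    rw [this]
    exact isClosed_iInter fun i => isClosed_singleton.preimage (f i).continuous
  have : IsClosed (K : Set E) := hKc
  obtain ⟨g, hg1, hgx⟩ := exists_dual_vector'' 𝕜 (K.mkQ x₀ : E ⧸ K)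
  let g' : StrongDual 𝕜 E := g.comp K.mkQL
  have hg'norm : ‖g'‖ ≤ 1 := by
    refine ContinuousLinearMap.opNorm_le_bound _ zero_le_one fun x => ?_
    calc ‖g (K.mkQ x)‖ ≤ ‖g‖ * ‖K.mkQ x‖ := g.le_opNorm _
      _ ≤ 1 * ‖x‖ := by
        gcongr
        exact Submodule.Quotient.norm_mk_le K x
  have hspan : (g' : E →ₗ[𝕜] 𝕜) ∈ Submodule.span 𝕜 (Set.range fun i => (f i : E →ₗ[𝕜] 𝕜)) := by
    refine mem_span_of_iInf_ker_le_ker fun x hx => ?_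
    have hxK : x ∈ K := by
      rw [LinearMap.mem_ker]
      ext i
      exact (Submodule.mem_iInf _).1 hx i
    rw [LinearMap.mem_ker]
    change g (K.mkQ x) = 0
    rw [(Submodule.Quotient.mk_eq_zero K).2 hxK |> fun h => (show K.mkQ x = 0 from h), map_zero]
  obtain ⟨a, ha⟩ := (Submodule.mem_span_range_iff_exists_fun 𝕜).1 hspan
  have hga : g' = ∑ i, a i • f i := by
    ext x
    have := LinearMap.congr_fun ha x
    simpa using this.symm
  have hnorm : ‖(K.mkQ x₀ : E ⧸ K)‖ ≤ M := by
    have h1 := h a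
    rw [← hga] at h1
    have h2 : ∑ i, a i * c i = g' x₀ := by
      rw [hga]; simp [hx₀i]
    have h3 : g' x₀ = ‖(K.mkQ x₀ : E ⧸ K)‖ := hgx
    rw [h2, h3, RCLike.norm_ofReal, abs_norm] at h1
    exact h1.trans (mul_le_of_le_one_right hM hg'norm)
  obtain ⟨x, hx, hxn⟩ := Submodule.Quotient.norm_mk_lt (S := K) (K.mkQ x₀ : E ⧸ K) hε
  refine ⟨x, by linarith, fun i => ?_⟩
  have h1 : x - x₀ ∈ K := (Submodule.Quotient.eq K).1 hx
  have h2 : f i (x - x₀) = 0 := congrFun (LinearMap.mem_ker.1 h1) i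
  rw [map_sub, sub_eq_zero] at h2
  rw [h2, hx₀i]

theorem exists_pos_forall_le_norm_sub {E : Type*} [SeminormedAddCommGroup E] {S : Set E}
    (hS : IsClosed S) {x : E} (hx : x ∉ S) : ∃ d > 0, ∀ y ∈ S, d ≤ ‖x - y‖ := by
  obtain ⟨d, hd, hball⟩ := Metric.isOpen_iff.1 hS.isOpen_compl x hx
  refine ⟨d, hd, fun y hy => ?_⟩
  by_contra hlt
  exact hball (mem_ball_iff_norm'.2 (not_le.1 hlt)) hy

/-- In a non-reflexive Banach space there are bounded sequences of functionals `g k` and vectors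
`z j` with `g k (z j) = 1` for `k ≤ j` and `g k (z j) = 0` for `j < k`. -/
theorem exists_triangular_system (𝕜 : Type w) [RCLike 𝕜] (Y : Type v)
    [NormedAddCommGroup Y] [NormedSpace 𝕜 Y] [CompleteSpace Y] (hY : ¬ IsReflexiveSpace 𝕜 Y) :
    ∃ C : ℝ, 0 < C ∧ ∃ (g : ℕ → StrongDual 𝕜 Y) (z : ℕ → Y), (∀ k, ‖g k‖ ≤ C) ∧
      (∀ j, ‖z j‖ ≤ C) ∧ (∀ k j, k ≤ j → g k (z j) = 1) ∧ ∀ k j, j < k → g k (z j) = 0 := by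
  classical
  obtain ⟨ξ, hξ⟩ : ∃ ξ, ∀ y, NormedSpace.inclusionInDoubleDual 𝕜 Y y ≠ ξ := by
    simpa [IsReflexiveSpace, Function.Surjective] using hY
  let J := NormedSpace.inclusionInDoubleDual 𝕜 Y
  have hiso : Isometry J := (NormedSpace.inclusionInDoubleDualLi 𝕜 (E := Y)).isometry
  have hclosed : IsClosed (Set.range J) := hiso.isClosedEmbedding.isClosed_range
  have hξr : ξ ∉ Set.range J := by rintro ⟨y, hy⟩; exact hξ y hy
  obtain ⟨d, hd, hdist'⟩ := exists_pos_forall_le_norm_sub hclosed hξr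
  have hdist : ∀ y : Y, d ≤ ‖ξ - J y‖ := fun y => hdist' _ ⟨y, rfl⟩
  obtain ⟨f, hfP, hfr⟩ := exists_seq_of_forall_finset_exists
    (fun p : StrongDual 𝕜 Y × Y => ‖p.1‖ ≤ 1 / d + 1 ∧ ‖p.2‖ ≤ ‖ξ‖ + 1 ∧ ξ p.1 = 1 ∧ p.1 p.2 = 1)
    (fun p q => q.1 p.2 = 0 ∧ p.1 q.2 = 1) (by
      intro s hs
      -- Helly's lemma in the dual, for the functionals `ξ` and `J z`
      obtain ⟨g, hgn, hg⟩ := exists_norm_le_forall_apply_eq (E := StrongDual 𝕜 Y)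
        (fun i : Option s => i.elim ξ fun p => J p.1.2) (fun i => i.elim 1 fun _ => 0)
        (M := 1 / d) (by positivity) (by
          intro a
          simp only [Fintype.sum_option, Option.elim_none, Option.elim_some, mul_one, mul_zero,
            Finset.sum_const_zero, add_zero]
          by_cases h0 : a none = 0
          · rw [h0, norm_zero]; positivity
          · have h1 : a none • ξ + ∑ p : s, a (some p) • J p.1.2 =
                a none • (ξ - J (-∑ p : s, ((a none)⁻¹ * a (some p)) • p.1.2)) := by
              simp only [map_neg, map_sum, map_smul, sub_neg_eq_add, smul_add, Finset.smul_sum,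
                smul_smul, mul_inv_cancel_left₀ h0]
            rw [h1, norm_smul]
            have h2 := hdist (-∑ p : s, ((a none)⁻¹ * a (some p)) • p.1.2)
            calc ‖a none‖ = 1 / d * (‖a none‖ * d) := by field_simp
              _ ≤ _ := by gcongr)
        (ε := 1) one_pos
      obtain ⟨z, hzn, hz⟩ := exists_norm_le_forall_apply_eq (E := Y)
        (fun i : Option s => i.elim g fun p => p.1.1) (fun _ => 1)
        (M := ‖ξ‖) (norm_nonneg ξ) (by
          intro a
          have h1 : ∑ i : Option s, a i * 1 =
              ξ (∑ i : Option s, a i • (i.elim g fun p => p.1.1 : StrongDual 𝕜 Y)) := by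
            rw [map_sum]
            refine Finset.sum_congr rfl fun i _ => ?_
            rw [map_smul, smul_eq_mul]
            congr 1
            cases i with
            | none => exact (hg none).symm
            | some p => exact (hs p.1 p.2).2.2.1.symm
          rw [h1]
          exact ξ.le_opNorm _)
        (ε := 1) one_pos
      refine ⟨(g, z), ⟨hgn, hzn, hg none, hz none⟩, fun p hp => ⟨?_, hz (some ⟨p, hp⟩)⟩⟩
      exact hg (some ⟨p, hp⟩))
  refine ⟨max (1 / d + 1) (‖ξ‖ + 1), by positivity, fun k => (f k).1, fun j => (f j).2,
    fun k => (hfP k).1.trans (le_max_left _ _), fun j => (hfP j).2.1.trans (le_max_right _ _),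
    fun k j hkj => ?_, fun k j hjk => (hfr j k hjk).1⟩
  rcases hkj.eq_or_lt with rfl | h
  · exact (hfP k).2.2.2
  · exact (hfr k j h).2

/-! ### James's interlacing argument -/

/-- Two interlacing sequences `p 0 < q 0 < p 1 < q 1 < ⋯` are merged into one. -/
theorem exists_strictMono_interleave {p q : ℕ → ℕ} (h1 : ∀ i, p i < q i)
    (h2 : ∀ i, q i < p (i + 1)) :
    ∃ s : ℕ → ℕ, StrictMono s ∧ (∀ i, s (2 * i) = p i) ∧ ∀ i, s (2 * i + 1) = q i := by
  refine ⟨fun n => if n % 2 = 0 then p (n / 2) else q (n / 2),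
    strictMono_nat_of_lt_succ fun n => ?_, fun i => ?_, fun i => ?_⟩
  · obtain ⟨i, rfl | rfl⟩ := Nat.even_or_odd' n
    · simpa [Nat.mul_add_mod, show (2 * i + 1) / 2 = i by omega] using h1 i
    · simpa [Nat.mul_add_mod, show (2 * i + 1) / 2 = i by omega,
        show (2 * i + 1 + 1) % 2 = 0 by omega, show (2 * i + 1 + 1) / 2 = i + 1 by omega] using h2 i
  · simp
  · simp [show (2 * i + 1) / 2 = i by omega]

section Alternating

variable {𝕜 : Type*} [RCLike 𝕜] {Y : Type*} [NormedAddCommGroup Y] [NormedSpace 𝕜 Y]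

/-- The vector `z` alternates on the first `e + 1` blocks `[u (2 * i), u (2 * i + 1)]`: every
functional `g k` with `k` in the `i`-th block takes the value `(-1) ^ i` at `z`. -/
def Alternates (g : ℕ → StrongDual 𝕜 Y) (e : ℕ) (u : ℕ → ℕ) (z : Y) : Prop :=
  ∀ i ≤ e, ∀ k, u (2 * i) ≤ k → k ≤ u (2 * i + 1) → g k z = (-1) ^ i

theorem Alternates.congr {g : ℕ → StrongDual 𝕜 Y} {e : ℕ} {u u' : ℕ → ℕ} {z : Y}
    (h : Alternates g e u z) (huu' : ∀ i < 2 * (e + 1), u i = u' i) : Alternates g e u' z := by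
  intro i hi k h1 h2
  rw [← huu' _ (by omega)] at h1 h2
  exact h i hi k h1 h2

/-- The norm of a vector alternating on `e + 1` blocks can be taken to grow linearly in `e`. -/
theorem exists_alternates {g : ℕ → StrongDual 𝕜 Y} {z : ℕ → Y} {C : ℝ}
    (hz : ∀ j, ‖z j‖ ≤ C) (hg1 : ∀ k j, k ≤ j → g k (z j) = 1)
    (hg0 : ∀ k j, j < k → g k (z j) = 0) {u : ℕ → ℕ} (hu : StrictMono u) (e : ℕ) :
    ∃ y, ‖y‖ ≤ 2 * C * (e + 1) ∧ Alternates g e u y := by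
  have hC : 0 ≤ C := (norm_nonneg _).trans (hz 0)
  suffices h : ∃ y, ‖y‖ ≤ 2 * C * (e + 1) ∧ Alternates g e u y ∧ ∀ k > u (2 * e + 1), g k y = 0 by
    obtain ⟨y, h1, h2, -⟩ := h
    exact ⟨y, h1, h2⟩
  induction e with
  | zero =>
    refine ⟨z (u 1), by have := hz (u 1); push_cast; linarith, ?_, fun k hk => hg0 _ _ hk⟩
    intro i hi k _ hk
    obtain rfl : i = 0 := by omega
    simpa using hg1 k _ hk
  | succ e ih =>
    obtain ⟨y, hyn, hya, hy0⟩ := ih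
    refine ⟨y + (-1 : 𝕜) ^ (e + 1) • (z (u (2 * (e + 1) + 1)) - z (u (2 * e + 1))), ?_, ?_, ?_⟩
    · have h1 := norm_add_le y
        ((-1 : 𝕜) ^ (e + 1) • (z (u (2 * (e + 1) + 1)) - z (u (2 * e + 1))))
      have h2 := norm_sub_le (z (u (2 * (e + 1) + 1))) (z (u (2 * e + 1)))
      rw [norm_smul, norm_pow, norm_neg, norm_one, one_pow, one_mul] at h1
      have h3 := hz (u (2 * (e + 1) + 1))
      have h4 := hz (u (2 * e + 1))
      push_cast
      linarith
    · intro i hi k h1 h2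
      rw [map_add, map_smul, map_sub, hg1 k _ (h2.trans (hu.monotone (by omega)))]
      rcases hi.eq_or_lt with rfl | hlt
      · have h3 : u (2 * e + 1) < k := (hu (by omega)).trans_le h1
        rw [hy0 _ h3, hg0 _ _ h3]
        simp
      · rw [hg1 k _ (h2.trans (hu.monotone (by omega))), hya i (by omega) k h1 h2]
        simp
    · intro k hk
      have h3 : u (2 * e + 1) < k := (hu (by omega)).trans hk
      rw [map_add, map_smul, map_sub, hg0 k _ hk, hg0 k _ h3, hy0 k h3]
      simp

end Alternating

/-- In a non-reflexive space there are `N` vectors of norm at most `ρ` for which all signed sums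
`x 0 + ⋯ + x (k - 1) - x k - ⋯ - x (N - 1)` have norm nearly as large as the triangle
inequality permits. The vectors are alternating with interlaced blocks, so that the signed
averages alternate on one block fewer; the growth of the minimal norm with the number of
blocks is at most linear, so for some number of blocks the loss is a factor at most `1 + δ`. -/
theorem exists_flat_sequence_of_not_reflexive (𝕜 : Type w) [RCLike 𝕜] (Y : Type v)
    [NormedAddCommGroup Y] [NormedSpace 𝕜 Y] [CompleteSpace Y] (hY : ¬ IsReflexiveSpace 𝕜 Y)
    {N : ℕ} (hN : 0 < N) {δ : ℝ} (hδ : 0 < δ) :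
    ∃ ρ : ℝ, 0 < ρ ∧ ∃ x : ℕ → Y, (∀ j, ‖x j‖ ≤ ρ) ∧ ∀ k ≤ N,
      ρ * N / (1 + δ) ≤ ‖∑ j ∈ Finset.range N, if j < k then x j else -x j‖ := by
  obtain ⟨C, hC, g, z, hg, hz, hg1, hg0⟩ := exists_triangular_system 𝕜 Y hY
  let Q : ℕ → (ℕ → ℕ) → Prop := fun e u => ∃ y, ‖y‖ ≤ (1 + δ) ^ e / (2 * C) ∧ Alternates g e u y
  have hQ0 : ∀ u, StrictMono u → ¬ Q 0 u := by
    rintro u hu ⟨y, hyn, hya⟩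
    have h1 := hya 0 le_rfl (u 0) le_rfl (hu (by omega)).le
    have h2 := (g (u 0)).le_of_opNorm_le (hg _) y
    rw [h1, pow_zero, norm_one] at h2
    have h3 : C * ‖y‖ ≤ C * ((1 + δ) ^ 0 / (2 * C)) := by gcongr
    have h4 : C * ((1 + δ) ^ 0 / (2 * C)) = 1 / 2 := by field_simp
    linarith
  obtain ⟨E, hE⟩ : ∃ E, ∀ u, StrictMono u → Q E u := by
    have h1 := tendsto_pow_const_div_const_pow_of_one_lt 1 (show 1 < 1 + δ by linarith)
    have h2 := h1.eventually_lt_const (show 0 < 1 / (8 * C ^ 2) by positivity)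
    obtain ⟨E, hE, hE1⟩ := (h2.and (Filter.eventually_ge_atTop 1)).exists
    refine ⟨E, fun u hu => ?_⟩
    obtain ⟨y, hyn, hya⟩ := exists_alternates hz hg1 hg0 hu E
    refine ⟨y, hyn.trans ?_, hya⟩
    have hp : 0 < (1 + δ) ^ E := by positivity
    rw [pow_one, div_lt_div_iff₀ hp (by positivity)] at hE
    rw [le_div_iff₀ (by positivity)]
    have hE1' : (1 : ℝ) ≤ E := by exact_mod_cast hE1
    nlinarith [sq_nonneg C]
  -- by Ramsey's theorem `Q e` may be assumed to hold for all or for no increasing sequences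
  obtain ⟨a, ha, hhom⟩ : ∃ a : ℕ → ℕ, StrictMono a ∧ ∀ s s' : ℕ → ℕ, StrictMono s → StrictMono s' →
      ∀ e ≤ E, Q e (a ∘ s) → Q e (a ∘ s') := by
    obtain ⟨a, ha, c, hc⟩ := exists_strictMono_tuple_colour_eq (r := 2 * (E + 1))
      (fun v => fun e : Fin (E + 1) => Q e fun i => if h : i < 2 * (E + 1) then v ⟨i, h⟩ else 0)
    have key : ∀ s : ℕ → ℕ, StrictMono s → ∀ e, ∀ he : e < E + 1, Q e (a ∘ s) ↔ c ⟨e, he⟩ := by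
      intro s hs e he
      have h1 := congrFun (hc (fun i => s i) fun i j hij => hs hij) ⟨e, he⟩
      rw [← h1]
      have h2 : ∀ i < 2 * (e + 1), (a ∘ s) i =
          if h : i < 2 * (E + 1) then (a ∘ fun j : Fin (2 * (E + 1)) => s j) ⟨i, h⟩ else 0 := by
        intro i hi
        rw [dif_pos (by omega)]
        rfl
      exact ⟨fun ⟨y, hy, hya⟩ => ⟨y, hy, hya.congr h2⟩,
        fun ⟨y, hy, hya⟩ => ⟨y, hy, hya.congr fun i hi => (h2 i hi).symm⟩⟩
    refine ⟨a, ha, fun s s' hs hs' e he h => ?_⟩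
    exact (key s' hs' e (by omega)).2 ((key s hs e (by omega)).1 h)
  obtain ⟨e, heE, he0, he1⟩ : ∃ e < E, ¬ Q e a ∧ Q (e + 1) a := by
    by_contra hcon
    push Not at hcon
    have h1 : ∀ e ≤ E, ¬ Q e a := by
      intro e
      induction e with
      | zero => exact fun _ => hQ0 a ha
      | succ e ih => exact fun he => hcon e (by omega) (ih (by omega))
    exact h1 E le_rfl (hE a ha)
  have hx : ∀ j, ∃ y, ‖y‖ ≤ (1 + δ) ^ (e + 1) / (2 * C) ∧ (j < N → ∀ i ≤ e + 1, ∀ t,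
      a (2 * (i * N + j) + 1) ≤ t → t ≤ a (2 * ((i + 1) * N + j)) → g t y = (-1) ^ i) := by
    intro j
    obtain ⟨s, hs, hsp, hsq⟩ := exists_strictMono_interleave
      (p := fun i => 2 * (i * N + j) + 1) (q := fun i => 2 * ((i + 1) * N + j))
      (fun i => by simp only [add_mul]; omega) (fun i => by omega)
    obtain ⟨y, hy, hya⟩ := hhom id s strictMono_id hs (e + 1) (by omega) he1
    refine ⟨y, hy, fun _ i hi t h1 h2 => hya i hi t ?_ ?_⟩
    · simpa [hsp] using h1
    · simpa [hsq] using h2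
  choose x hxn hxa using hx
  refine ⟨(1 + δ) ^ (e + 1) / (2 * C), by positivity, x, hxn, fun k hk => ?_⟩
  by_contra hlt
  rw [not_le] at hlt
  obtain ⟨s, hs, hsp, hsq⟩ := exists_strictMono_interleave
    (p := fun i => 2 * ((i + 1) * N + k - 1) + 1) (q := fun i => 2 * ((i + 1) * N + k))
    (fun i => by simp only [add_mul]; omega) (fun i => by simp only [add_mul]; omega)
  refine he0 (hhom s id hs strictMono_id e heE.le ⟨-((N : 𝕜)⁻¹ •
    ∑ j ∈ Finset.range N, if j < k then x j else -x j), ?_, ?_⟩)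
  · rw [norm_neg, norm_smul, norm_inv, RCLike.norm_natCast]
    have hN' : (0 : ℝ) < N := by exact_mod_cast hN
    calc _ ≤ (N : ℝ)⁻¹ * ((1 + δ) ^ (e + 1) / (2 * C) * N / (1 + δ)) := by gcongr
      _ = _ := by rw [pow_succ]; field_simp
  · intro i hi t h1 h2
    simp only [Function.comp, hsp, hsq] at h1 h2
    have hterm : ∀ j ∈ Finset.range N, g t (if j < k then x j else -x j) = (-1) ^ (i + 1) := by
      intro j hj
      rw [Finset.mem_range] at hj
      split_ifs with hjk
      · refine hxa j hj (i + 1) (by omega) t (le_trans (ha.monotone ?_) h1)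
          (h2.trans (ha.monotone ?_))
        · omega
        · simp only [add_mul]; omega
      · rw [map_neg, hxa j hj i (by omega) t (le_trans (ha.monotone ?_) h1)
          (h2.trans (ha.monotone ?_))]
        · ring
        · simp only [add_mul]; omega
        · omega
    have hN' : (N : 𝕜) ≠ 0 := by exact_mod_cast hN.ne'
    rw [map_neg, map_smul, map_sum, Finset.sum_congr rfl hterm, Finset.sum_const,
      Finset.card_range, nsmul_eq_mul, smul_eq_mul, inv_mul_cancel_left₀ hN']
    ring

/-- A space that is not super-reflexive contains flat sequences of every length in its unit
ball. -/
theorem exists_flat_sequence_of_not_superReflexive (𝕜 : Type w) [RCLike 𝕜] (X : Type u)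
    [NormedAddCommGroup X] [NormedSpace 𝕜 X] (hX : ¬ IsSuperReflexive.{u, v, w} 𝕜 X)
    {N : ℕ} (hN : 0 < N) {δ : ℝ} (hδ : 0 < δ) :
    ∃ x : ℕ → X, (∀ j, ‖x j‖ ≤ 1) ∧ ∀ k ≤ N,
      N / (1 + δ) ≤ ‖∑ j ∈ Finset.range N, if j < k then x j else -x j‖ := by
  classical
  simp only [IsSuperReflexive, not_forall] at hX
  obtain ⟨Y, _, _, _, hYX, hY⟩ := hX
  -- the loss `1 + δ` is shared equally between `Y` and the passage to `X`
  obtain ⟨η, hη, hηδ⟩ : ∃ η > 0, (1 + η) * (1 + η) = 1 + δ := by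
    refine ⟨√(1 + δ) - 1, ?_, ?_⟩
    · rw [gt_iff_lt, sub_pos]
      exact Real.lt_sqrt_of_sq_lt (by linarith)
    · rw [add_sub_cancel, Real.mul_self_sqrt (by linarith)]
  obtain ⟨ρ, hρ, y, hyn, hy⟩ := exists_flat_sequence_of_not_reflexive 𝕜 Y hY hN hη
  let F : Submodule 𝕜 Y := Submodule.span 𝕜 ((Finset.range N).image y : Finset Y)
  obtain ⟨S, hS⟩ := hYX F inferInstance η hη
  have hmem : ∀ j < N, y j ∈ F := fun j hj => Submodule.subset_span
    (Finset.mem_coe.2 (Finset.mem_image_of_mem _ (Finset.mem_range.2 hj)))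
  let b : ℕ → F := fun j => if h : j < N then ⟨y j, hmem j h⟩ else 0
  have hb : ∀ j < N, (b j : Y) = y j := fun j hj => by simp [b, hj]
  have hbn : ∀ j, ‖b j‖ ≤ ρ := fun j => by
    by_cases hj : j < N
    · rw [Submodule.coe_norm, hb j hj]; exact hyn j
    · simp [b, hj, hρ.le]
  let r : 𝕜 := ((((1 + η) * ρ)⁻¹ : ℝ) : 𝕜)
  have hr : ‖r‖ = ((1 + η) * ρ)⁻¹ := by
    rw [RCLike.norm_ofReal, abs_of_pos (by positivity)]
  refine ⟨fun j => r • S (b j), fun j => ?_, fun k hk => ?_⟩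
  · rw [norm_smul, hr, inv_mul_le_iff₀ (by positivity), mul_one]
    exact ((hS _).2).trans (by gcongr; exact hbn j)
  · have h1 : (∑ j ∈ Finset.range N, if j < k then r • S (b j) else -(r • S (b j))) =
        r • S (∑ j ∈ Finset.range N, if j < k then b j else -b j) := by
      rw [map_sum, Finset.smul_sum]
      refine Finset.sum_congr rfl fun j _ => ?_
      split_ifs <;> simp
    have h2 : ((∑ j ∈ Finset.range N, if j < k then b j else -b j : F) : Y) =
        ∑ j ∈ Finset.range N, if j < k then y j else -y j := by
      rw [Submodule.coe_sum]
      refine Finset.sum_congr rfl fun j hj => ?_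
      rw [Finset.mem_range] at hj
      split_ifs <;> simp [hb j hj]
    rw [h1, norm_smul, hr]
    have h3 := (hS (∑ j ∈ Finset.range N, if j < k then b j else -b j)).1
    rw [Submodule.coe_norm, h2] at h3
    have h4 := (hy k hk).trans h3
    calc N / (1 + δ) = ((1 + η) * ρ)⁻¹ * (ρ * N / (1 + η)) := by rw [← hηδ]; field_simp
      _ ≤ _ := by gcongr

/-- If a signed sum of `N` vectors of the unit ball is nearly as long as possible, then a norming
functional is nearly one on each signed summand. -/
theorem exists_dual_of_flat {X : Type*} [NormedAddCommGroup X] [NormedSpace ℝ X] {x : ℕ → X}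
    (hx : ∀ j, ‖x j‖ ≤ 1) {N k : ℕ} {δ : ℝ} (hδ : 0 < δ)
    (h : N / (1 + δ) ≤ ‖∑ j ∈ Finset.range N, if j < k then x j else -x j‖) :
    ∃ ψ : StrongDual ℝ X, ‖ψ‖ ≤ 1 ∧ (∀ j < k, j < N → 1 - N * δ ≤ ψ (x j)) ∧
      ∀ j, k ≤ j → j < N → ψ (x j) ≤ -(1 - N * δ) := by
  obtain ⟨ψ, hψ, hψx⟩ := exists_dual_vector'' ℝ
    (∑ j ∈ Finset.range N, if j < k then x j else -x j)
  have hle : ∀ j, ψ (if j < k then x j else -x j) ≤ 1 := by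
    intro j
    have h1 : ‖if j < k then x j else -x j‖ ≤ 1 := by split_ifs <;> simp [hx j]
    exact (le_abs_self _).trans ((ψ.le_of_opNorm_le hψ _).trans (by linarith))
  have key : ∀ j < N, 1 - N * δ ≤ ψ (if j < k then x j else -x j) := by
    intro j hj
    have h1 : N / (1 + δ) ≤ ∑ i ∈ Finset.range N, ψ (if i < k then x i else -x i) := by
      rw [← map_sum, hψx]; exact h
    rw [← Finset.add_sum_erase _ _ (Finset.mem_range.2 hj)] at h1
    have h2 : ∑ i ∈ (Finset.range N).erase j, ψ (if i < k then x i else -x i) ≤ N - 1 := by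
      refine (Finset.sum_le_card_nsmul _ _ 1 fun i _ => hle i).trans ?_
      rw [Finset.card_erase_of_mem (Finset.mem_range.2 hj), Finset.card_range, nsmul_eq_mul,
        mul_one, Nat.cast_pred (by omega)]
    have h3 : (N : ℝ) - N * δ ≤ N / (1 + δ) := by
      rw [le_div_iff₀ (by positivity)]
      nlinarith [mul_nonneg (Nat.cast_nonneg (α := ℝ) N) (sq_nonneg δ)]
    linarith
  refine ⟨ψ, hψ, fun j hjk hj => ?_, fun j hjk hj => ?_⟩
  · simpa [hjk] using key j hj
  · have := key j hj
    rw [if_neg (by omega), map_neg] at this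
    linarith

/-! ### Distances after replacing edges -/

namespace EdgeGraph

variable (G : EdgeGraph)

theorem dist_src_tgt_le_one (e : G.E) : G.toSimpleGraph.dist (G.src e) (G.tgt e) ≤ 1 := by
  by_cases h : G.src e = G.tgt e
  · rw [h, SimpleGraph.dist_self]; exact zero_le_one
  · have h1 : G.toSimpleGraph.Adj (G.src e) (G.tgt e) :=
      (SimpleGraph.fromRel_adj _ _ _).2 ⟨h, Or.inl ⟨e, rfl, rfl⟩⟩
    exact (SimpleGraph.dist_eq_one_iff_adj.2 h1).le

/-- A vertex of `G`, in the graph with the edges replaced. -/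
def oldVertex (u : G.V) : G.replaceEdges.V := Sum.inl u

/-- One of the four vertices that replace the edge `e`. -/
def newVertex (e : G.E) (i : LaaksoInner) : G.replaceEdges.V := Sum.inr (e, i)

/-- One of the six edges that replace the edge `e`. -/
def newEdge (e : G.E) (l : LaaksoEdge) : G.replaceEdges.E := (e, l)

variable {G}

/-- A preorder that holds along the six new edges of `e` compares the ends of `e` with them. -/
theorem rel_of_rel_newEdges {e : G.E} {r : G.replaceEdges.V → G.replaceEdges.V → Prop}
    (hrefl : ∀ u, r u u) (htrans : ∀ u v w, r u v → r v w → r u w)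
    (hedge : ∀ l, r (G.replaceEdges.src (G.newEdge e l)) (G.replaceEdges.tgt (G.newEdge e l)))
    (l : LaaksoEdge) :
    r (G.oldVertex (G.src e)) (G.replaceEdges.src (G.newEdge e l)) ∧
      r (G.replaceEdges.tgt (G.newEdge e l)) (G.oldVertex (G.tgt e)) := by
  have hY : r (G.oldVertex (G.src e)) (G.newVertex e .T) := hedge .Y
  have hC : r (G.newVertex e .T) (G.newVertex e .L) := hedge .C
  have hD : r (G.newVertex e .T) (G.newVertex e .R) := hedge .D
  have hE : r (G.newVertex e .L) (G.newVertex e .B) := hedge .E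
  have hF : r (G.newVertex e .R) (G.newVertex e .B) := hedge .F
  have hZ : r (G.newVertex e .B) (G.oldVertex (G.tgt e)) := hedge .Z
  cases l with
  | Y => exact ⟨hrefl _, htrans _ _ _ hC (htrans _ _ _ hE hZ)⟩
  | C => exact ⟨hY, htrans _ _ _ hE hZ⟩
  | D => exact ⟨hY, htrans _ _ _ hF hZ⟩
  | E => exact ⟨htrans _ _ _ hY hC, hZ⟩
  | F => exact ⟨htrans _ _ _ hY hD, hZ⟩
  | Z => exact ⟨htrans _ _ _ hY (htrans _ _ _ hC hE), hrefl _⟩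

/-- The graded version of `rel_of_rel_newEdges`: the offsets of a new edge from the two ends of
`e` sum up to three. -/
theorem exists_rel_of_rel_newEdges {e : G.E} {r : ℕ → G.replaceEdges.V → G.replaceEdges.V → Prop}
    (hrefl : ∀ u, r 0 u u) (htrans : ∀ m n u v w, r m u v → r n v w → r (m + n) u w)
    (hedge : ∀ l, r 1 (G.replaceEdges.src (G.newEdge e l)) (G.replaceEdges.tgt (G.newEdge e l)))
    (l : LaaksoEdge) :
    ∃ s t, s + t = 3 ∧ r s (G.oldVertex (G.src e)) (G.replaceEdges.src (G.newEdge e l)) ∧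
      r t (G.replaceEdges.tgt (G.newEdge e l)) (G.oldVertex (G.tgt e)) := by
  have hY : r 1 (G.oldVertex (G.src e)) (G.newVertex e .T) := hedge .Y
  have hC : r 1 (G.newVertex e .T) (G.newVertex e .L) := hedge .C
  have hD : r 1 (G.newVertex e .T) (G.newVertex e .R) := hedge .D
  have hE : r 1 (G.newVertex e .L) (G.newVertex e .B) := hedge .E
  have hF : r 1 (G.newVertex e .R) (G.newVertex e .B) := hedge .F
  have hZ : r 1 (G.newVertex e .B) (G.oldVertex (G.tgt e)) := hedge .Z
  cases l with
  | Y => exact ⟨0, 3, rfl, hrefl _, htrans 1 2 _ _ _ hC (htrans 1 1 _ _ _ hE hZ)⟩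
  | C => exact ⟨1, 2, rfl, hY, htrans 1 1 _ _ _ hE hZ⟩
  | D => exact ⟨1, 2, rfl, hY, htrans 1 1 _ _ _ hF hZ⟩
  | E => exact ⟨2, 1, rfl, htrans 1 1 _ _ _ hY hC, hZ⟩
  | F => exact ⟨2, 1, rfl, htrans 1 1 _ _ _ hY hD, hZ⟩
  | Z => exact ⟨3, 0, rfl, htrans 1 2 _ _ _ hY (htrans 1 1 _ _ _ hC hE), hrefl _⟩

theorem dist_inl_inl_le (hG : G.toSimpleGraph.Connected) (u v : G.V) :
    G.replaceEdges.toSimpleGraph.dist (G.oldVertex u) (G.oldVertex v) ≤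
      4 * G.toSimpleGraph.dist u v := by
  have hG' := G.replaceEdges_connected hG
  have hedge : ∀ e : G.E,
      G.replaceEdges.toSimpleGraph.dist (G.oldVertex (G.src e)) (G.oldVertex (G.tgt e)) ≤ 4 := by
    intro e
    obtain ⟨s, t, hst, h1, h2⟩ := exists_rel_of_rel_newEdges (e := e)
      (r := fun m u v => G.replaceEdges.toSimpleGraph.dist u v ≤ m)
      (fun u => by simp) (fun m n u v w h1 h2 => hG'.dist_triangle.trans (add_le_add h1 h2))
      (fun l => G.replaceEdges.dist_src_tgt_le_one (G.newEdge e l)) .Z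
    have h3 := G.replaceEdges.dist_src_tgt_le_one (G.newEdge e .Z)
    have h4 := hG'.dist_triangle (u := G.oldVertex (G.src e))
      (v := G.replaceEdges.src (G.newEdge e .Z))
      (w := G.oldVertex (G.tgt e))
    have h5 := hG'.dist_triangle (u := G.replaceEdges.src (G.newEdge e .Z))
      (v := G.replaceEdges.tgt (G.newEdge e .Z)) (w := G.oldVertex (G.tgt e))
    omega
  obtain ⟨p, hp⟩ := hG.exists_walk_length_eq_dist u v
  rw [← hp]
  clear hp
  induction p with
  | nil => simp
  | @cons a b c h p ih =>
    have h1 : G.replaceEdges.toSimpleGraph.dist (G.oldVertex a) (G.oldVertex b) ≤ 4 := by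
      obtain ⟨-, ⟨e, rfl, rfl⟩ | ⟨e, rfl, rfl⟩⟩ := (SimpleGraph.fromRel_adj _ _ _).1 h
      · exact hedge e
      · rw [SimpleGraph.dist_comm]; exact hedge e
    have h2 := hG'.dist_triangle (u := G.oldVertex a) (v := G.oldVertex b) (w := G.oldVertex c)
    rw [SimpleGraph.Walk.length_cons]
    omega

end EdgeGraph

/-! ### Drawings of labelled graphs -/

section Drawing

variable {X : Type*} [NormedAddCommGroup X] [NormedSpace ℝ X]

/-- The average of `x` over the interval `[s, s + 2 ^ j)`. -/
noncomputable def dyadicAverage (x : ℕ → X) : ℕ → ℕ → X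
  | 0, s => x s
  | j + 1, s => (1 / 2 : ℝ) • (dyadicAverage x j s + dyadicAverage x j (s + 2 ^ j))

theorem le_apply_dyadicAverage {x : ℕ → X} {ψ : StrongDual ℝ X} {b : ℝ} {j s : ℕ}
    (h : ∀ i ∈ Set.Ico s (s + 2 ^ j), b ≤ ψ (x i)) : b ≤ ψ (dyadicAverage x j s) := by
  induction j generalizing s with
  | zero => exact h s ⟨le_rfl, by simp⟩
  | succ j ih =>
    have h1 := ih (s := s) fun i hi => h i ⟨hi.1, by have := hi.2; rw [pow_succ]; omega⟩
    have h2 := ih (s := s + 2 ^ j) fun i hi => h i ⟨(Nat.le_add_right _ _).trans hi.1, by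
      have := hi.2; rw [pow_succ]; omega⟩
    rw [dyadicAverage, map_smul, map_add, smul_eq_mul]
    linarith

theorem apply_dyadicAverage_le {x : ℕ → X} {ψ : StrongDual ℝ X} {b : ℝ} {j s : ℕ}
    (h : ∀ i ∈ Set.Ico s (s + 2 ^ j), ψ (x i) ≤ b) : ψ (dyadicAverage x j s) ≤ b := by
  have := le_apply_dyadicAverage (x := x) (ψ := -ψ) (b := -b) (j := j) (s := s)
    fun i hi => by simpa using h i hi
  simpa using this

/-- A drawing of a graph in `X`, whose edges are regarded as having length `4 ^ j`: every edge is
labelled by a dyadic interval of `2 ^ j` indices below `N`, and the direction of the edge is the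
average of `x` over this interval. -/
structure Drawing (x : ℕ → X) (N j : ℕ) (G : EdgeGraph) where
  /-- The position of a vertex. -/
  pos : G.V → X
  /-- The first index of the interval that labels an edge. -/
  lbl : G.E → ℕ
  pos_tgt : ∀ e, pos (G.tgt e) = pos (G.src e) + (4 : ℝ) ^ j • dyadicAverage x j (lbl e)
  lbl_le : ∀ e, lbl e + 2 ^ j ≤ N

namespace Drawing

variable {x : ℕ → X} {N j : ℕ} {G : EdgeGraph}

/-- The indices that label an edge. -/
def interval (D : Drawing x N j G) (e : G.E) : Set ℕ := Set.Ico (D.lbl e) (D.lbl e + 2 ^ j)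

/-- The drawing of the graph with its edges replaced. The first halves of the interval of an edge
label the edges `pT`, `TL`, `RB`, the second halves label `TR`, `LB`, `Bq`. Thus the two
branches between `T` and `B` use the two halves in opposite orders. -/
noncomputable def refine (D : Drawing x N (j + 1) G) : Drawing x N j G.replaceEdges where
  pos
    | .inl u => D.pos u
    | .inr (e, .T) => D.pos (G.src e) + (4 : ℝ) ^ j • dyadicAverage x j (D.lbl e)
    | .inr (e, .L) => D.pos (G.src e) + (4 : ℝ) ^ j • (dyadicAverage x j (D.lbl e) +
        dyadicAverage x j (D.lbl e))
    | .inr (e, .R) => D.pos (G.src e) + (4 : ℝ) ^ j • (dyadicAverage x j (D.lbl e) +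
        dyadicAverage x j (D.lbl e + 2 ^ j))
    | .inr (e, .B) => D.pos (G.src e) + (4 : ℝ) ^ j • (dyadicAverage x j (D.lbl e) +
        dyadicAverage x j (D.lbl e) + dyadicAverage x j (D.lbl e + 2 ^ j))
  lbl
    | (e, .Y) => D.lbl e
    | (e, .C) => D.lbl e
    | (e, .D) => D.lbl e + 2 ^ j
    | (e, .E) => D.lbl e + 2 ^ j
    | (e, .F) => D.lbl e
    | (e, .Z) => D.lbl e + 2 ^ j
  pos_tgt := by
    rintro ⟨e, _ | _ | _ | _ | _ | _⟩
    · rfl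
    · simp only [EdgeGraph.replaceEdges]; module
    · simp only [EdgeGraph.replaceEdges]; module
    · simp only [EdgeGraph.replaceEdges]; module
    · simp only [EdgeGraph.replaceEdges]; module
    · simp only [EdgeGraph.replaceEdges, D.pos_tgt e, dyadicAverage]
      rw [pow_succ]
      module
  lbl_le := by
    rintro ⟨e, _ | _ | _ | _ | _ | _⟩ <;>
    · have h := D.lbl_le e
      rw [pow_succ] at h
      simp only
      omega

theorem interval_refine_subset (D : Drawing x N (j + 1) G) (e : G.E) (l : LaaksoEdge) :
    D.refine.interval (G.newEdge e l) ⊆ D.interval e := by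
  intro i hi
  have h1 := hi.1
  have h2 := hi.2
  have h3 : D.lbl e ≤ i ∧ i < D.lbl e + 2 ^ j * 2 := by
    cases l <;> simp only [refine, EdgeGraph.newEdge] at h1 h2 <;> omega
  exact ⟨h3.1, by rw [pow_succ]; exact h3.2⟩

/-- The functional `ψ` sees the distance from `u` to `w` up to the factor `c`. -/
def Climb (D : Drawing x N j G) (c : ℝ) (ψ : StrongDual ℝ X) (u w : G.V) : Prop :=
  c * 4 ^ j * G.toSimpleGraph.dist u w ≤ ψ (D.pos w) - ψ (D.pos u)

theorem Climb.refl (D : Drawing x N j G) (c : ℝ) (ψ : StrongDual ℝ X) (u : G.V) :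
    D.Climb c ψ u u := by
  simp [Climb]

theorem Climb.trans {D : Drawing x N j G} {c : ℝ} (hc : 0 ≤ c) (hG : G.toSimpleGraph.Connected)
    {ψ : StrongDual ℝ X} {u v w : G.V} (h1 : D.Climb c ψ u v) (h2 : D.Climb c ψ v w) :
    D.Climb c ψ u w := by
  have h3 : (G.toSimpleGraph.dist u w : ℝ) ≤
      G.toSimpleGraph.dist u v + G.toSimpleGraph.dist v w := by
    exact_mod_cast hG.dist_triangle
  have h4 := mul_le_mul_of_nonneg_left h3 (show 0 ≤ c * 4 ^ j by positivity)
  simp only [Climb] at *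
  linarith

theorem Climb.neg {D : Drawing x N j G} {c : ℝ} {ψ : StrongDual ℝ X} {u w : G.V}
    (h : D.Climb c ψ u w) : D.Climb c (-ψ) w u := by
  simp only [Climb, neg_apply] at *
  rw [SimpleGraph.dist_comm]
  linarith

theorem climb_src_tgt {D : Drawing x N j G} {c : ℝ} (hc : 0 ≤ c) {ψ : StrongDual ℝ X} {e : G.E}
    (h : ∀ i ∈ D.interval e, c ≤ ψ (x i)) : D.Climb c ψ (G.src e) (G.tgt e) := by
  have h1 := le_apply_dyadicAverage h
  have h2 : (G.toSimpleGraph.dist (G.src e) (G.tgt e) : ℝ) ≤ 1 := by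
    exact_mod_cast G.dist_src_tgt_le_one e
  rw [Climb, D.pos_tgt, map_add, map_smul, smul_eq_mul, add_sub_cancel_left]
  calc _ ≤ c * 4 ^ j * 1 := by gcongr
    _ = 4 ^ j * c := by ring
    _ ≤ _ := by gcongr

theorem Climb.refine {D : Drawing x N (j + 1) G} {c : ℝ} (hc : 0 ≤ c)
    (hG : G.toSimpleGraph.Connected) {ψ : StrongDual ℝ X} {u w : G.V} (h : D.Climb c ψ u w) :
    D.refine.Climb c ψ (G.oldVertex u) (G.oldVertex w) := by
  have h1 : (G.replaceEdges.toSimpleGraph.dist (G.oldVertex u) (G.oldVertex w) : ℝ) ≤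
      4 * G.toSimpleGraph.dist u w := by exact_mod_cast EdgeGraph.dist_inl_inl_le hG u w
  have h2 := mul_le_mul_of_nonneg_left h1 (show 0 ≤ c * 4 ^ j by positivity)
  simp only [Climb] at *
  rw [pow_succ] at h
  exact h2.trans (le_trans (le_of_eq (by ring)) h)

/-- The vertex `u` is an end of `e` from which `ψ` climbs along `e`. -/
def Anchor (D : Drawing x N j G) (c : ℝ) (ψ : StrongDual ℝ X) (e : G.E) (u : G.V) : Prop :=
  (u = G.src e ∧ ∀ i ∈ D.interval e, c ≤ ψ (x i)) ∨
    (u = G.tgt e ∧ ∀ i ∈ D.interval e, ψ (x i) ≤ -c)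

theorem Anchor.climb {D : Drawing x N j G} {c : ℝ} (hc : 0 ≤ c) {ψ : StrongDual ℝ X} {e : G.E}
    {u w : G.V} (h : D.Anchor c ψ e u) (hw : w = G.src e ∨ w = G.tgt e) : D.Climb c ψ u w := by
  obtain ⟨rfl, h⟩ | ⟨rfl, h⟩ := h
  · obtain rfl | rfl := hw
    · exact Climb.refl _ _ _ _
    · exact climb_src_tgt hc h
  · obtain rfl | rfl := hw
    · have h1 : D.Climb c (-ψ) (G.src e) (G.tgt e) :=
        climb_src_tgt hc fun i hi => by have := h i hi; simp only [neg_apply]; linarith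
      simpa using h1.neg
    · exact Climb.refl _ _ _ _

theorem Anchor.refine {D : Drawing x N (j + 1) G} {c : ℝ} (hc : 0 ≤ c)
    (hG : G.toSimpleGraph.Connected) {ψ : StrongDual ℝ X} {e : G.E} {u : G.V}
    (h : D.Anchor c ψ e u) (l : LaaksoEdge) :
    ∃ w, D.refine.Anchor c ψ (G.newEdge e l) w ∧ D.refine.Climb c ψ (G.oldVertex u) w := by
  have hG' := G.replaceEdges_connected hG
  obtain ⟨rfl, h⟩ | ⟨rfl, h⟩ := h
  · have h1 : ∀ l, ∀ i ∈ D.refine.interval (G.newEdge e l), c ≤ ψ (x i) :=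
      fun l i hi => h i (D.interval_refine_subset e l hi)
    exact ⟨_, Or.inl ⟨rfl, h1 l⟩, (EdgeGraph.rel_of_rel_newEdges (r := D.refine.Climb c ψ)
      (Climb.refl _ _ _) (fun _ _ _ => Climb.trans hc hG') (fun l => climb_src_tgt hc (h1 l)) l).1⟩
  · have h1 : ∀ l, ∀ i ∈ D.refine.interval (G.newEdge e l), ψ (x i) ≤ -c :=
      fun l i hi => h i (D.interval_refine_subset e l hi)
    have h2 : ∀ l, D.refine.Anchor c ψ (G.newEdge e l) (G.replaceEdges.tgt (G.newEdge e l)) :=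
      fun l => Or.inr ⟨rfl, h1 l⟩
    exact ⟨_, h2 l, (EdgeGraph.rel_of_rel_newEdges (r := fun u w => D.refine.Climb c ψ w u)
      (Climb.refl _ _ _) (fun _ _ _ h3 h4 => Climb.trans hc hG' h4 h3)
      (fun l => (h2 l).climb hc (Or.inl rfl)) l).2⟩

/-- A single functional sees, up to the factor `c`, all distances between points of `e` and points
of `e'`: it climbs along `e'` to an end of `e'`, from there to an end of `e`, and then along
`e`. -/
def Separated (D : Drawing x N j G) (c : ℝ) (e e' : G.E) : Prop :=
  ∃ ψ : StrongDual ℝ X, ‖ψ‖ ≤ 1 ∧ ∃ u u', D.Anchor c ψ e u ∧ D.Anchor c (-ψ) e' u' ∧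
    D.Climb c ψ u' u

theorem Separated.symm {D : Drawing x N j G} {c : ℝ} {e e' : G.E} (h : D.Separated c e e') :
    D.Separated c e' e := by
  obtain ⟨ψ, hψ, u, u', h1, h2, h3⟩ := h
  exact ⟨-ψ, by rwa [norm_neg], u', u, h2, by rwa [neg_neg], h3.neg⟩

theorem Separated.refine {D : Drawing x N (j + 1) G} {c : ℝ} (hc : 0 ≤ c)
    (hG : G.toSimpleGraph.Connected) {e e' : G.E} (h : D.Separated c e e') (l l' : LaaksoEdge) :
    D.refine.Separated c (G.newEdge e l) (G.newEdge e' l') := by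
  have hG' := G.replaceEdges_connected hG
  obtain ⟨ψ, hψ, u, u', h1, h2, h3⟩ := h
  obtain ⟨w, hw, huw⟩ := h1.refine hc hG l
  obtain ⟨w', hw', huw'⟩ := h2.refine hc hG l'
  refine ⟨ψ, hψ, w, w', hw, hw', ?_⟩
  have h4 := huw'.neg
  rw [neg_neg] at h4
  exact (h4.trans hc hG' (h3.refine hc hG)).trans hc hG' huw

/-- The edge `e` lies on the upper part of one branch of a Laakso graph of level one and the edge
`e'` on the lower part of the other branch, the four branch parts having length `K / 4`. Here
`α` and `β` bound the distances between the sources and between the targets. The functional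
`ψ` sees the lower part of the branch of `e`, but is almost zero on `e` and `e'`. -/
def Crossed (D : Drawing x N j G) (c : ℝ) (e e' : G.E) : Prop :=
  ∃ ψ : StrongDual ℝ X, ‖ψ‖ ≤ 1 ∧ (∀ i ∈ D.interval e, |ψ (x i)| ≤ 1 - c) ∧
    (∀ i ∈ D.interval e', |ψ (x i)| ≤ 1 - c) ∧ ∃ α β K : ℝ,
      4 ^ j * G.toSimpleGraph.dist (G.src e) (G.src e') ≤ α ∧
      4 ^ j * G.toSimpleGraph.dist (G.tgt e) (G.tgt e') ≤ β ∧ α + β + 2 * 4 ^ j = K ∧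
      c * K / 4 - (1 - c) * α ≤ ψ (D.pos (G.src e)) - ψ (D.pos (G.src e'))

/-- The offsets `s` and `t` of a new edge from the ends of `e`. A functional bounded by `δ` on the
vectors that label `e` changes by at most `δ` per unit of length on the way. -/
theorem exists_offsets (D : Drawing x N (j + 1) G) (hG : G.toSimpleGraph.Connected) {e : G.E}
    {ψ : StrongDual ℝ X} {δ : ℝ} (h : ∀ i ∈ D.interval e, |ψ (x i)| ≤ δ) (l : LaaksoEdge) :
    ∃ s t : ℕ, s + t = 3 ∧
      G.replaceEdges.toSimpleGraph.dist (G.oldVertex (G.src e))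
        (G.replaceEdges.src (G.newEdge e l)) ≤ s ∧
      |ψ (D.refine.pos (G.replaceEdges.src (G.newEdge e l))) - ψ (D.pos (G.src e))| ≤
        δ * (s * 4 ^ j) ∧
      G.replaceEdges.toSimpleGraph.dist (G.replaceEdges.tgt (G.newEdge e l))
        (G.oldVertex (G.tgt e)) ≤ t := by
  have hG' := G.replaceEdges_connected hG
  obtain ⟨s, t, hst, h1, h2⟩ := EdgeGraph.exists_rel_of_rel_newEdges (e := e)
    (r := fun m u w => G.replaceEdges.toSimpleGraph.dist u w ≤ m ∧
      |ψ (D.refine.pos w) - ψ (D.refine.pos u)| ≤ δ * (m * 4 ^ j))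
    (fun u => by simp)
    (fun m n u v w h1 h2 => by
      refine ⟨hG'.dist_triangle.trans (add_le_add h1.1 h2.1), ?_⟩
      have h3 := abs_sub_le (ψ (D.refine.pos w)) (ψ (D.refine.pos v)) (ψ (D.refine.pos u))
      push_cast
      linarith [h1.2, h2.2])
    (fun l => by
      refine ⟨G.replaceEdges.dist_src_tgt_le_one (G.newEdge e l), ?_⟩
      rw [D.refine.pos_tgt, map_add, map_smul, smul_eq_mul, add_sub_cancel_left, abs_mul,
        abs_of_pos (by positivity : (0 : ℝ) < 4 ^ j), Nat.cast_one, one_mul, mul_comm]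
      have h3 : ∀ i ∈ D.refine.interval (G.newEdge e l), |ψ (x i)| ≤ δ :=
        fun i hi => h i (D.interval_refine_subset e l hi)
      have h4 : |ψ (dyadicAverage x j (D.refine.lbl (G.newEdge e l)))| ≤ δ :=
        abs_le.2 ⟨le_apply_dyadicAverage fun i hi => (abs_le.1 (h3 i hi)).1,
          apply_dyadicAverage_le fun i hi => (abs_le.1 (h3 i hi)).2⟩
      gcongr) l
  exact ⟨s, t, hst, h1.1, h1.2, h2.1⟩

theorem Crossed.refine {D : Drawing x N (j + 1) G} {c : ℝ}
    (hG : G.toSimpleGraph.Connected) {e e' : G.E} (h : D.Crossed c e e') (l l' : LaaksoEdge) :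
    D.refine.Crossed c (G.newEdge e l) (G.newEdge e' l') := by
  have hG' := G.replaceEdges_connected hG
  obtain ⟨ψ, hψ, h1, h2, α, β, K, hα, hβ, hK, h3⟩ := h
  obtain ⟨s, t, hst, hs, hsψ, ht⟩ := D.exists_offsets hG h1 l
  obtain ⟨s', t', hst', hs', hsψ', ht'⟩ := D.exists_offsets hG h2 l'
  refine ⟨ψ, hψ, fun i hi => h1 i (D.interval_refine_subset e l hi),
    fun i hi => h2 i (D.interval_refine_subset e' l' hi), α + (s + s') * 4 ^ j,
    β + (t + t') * 4 ^ j, K, ?_, ?_, ?_, ?_⟩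
  · have h4 := hG'.dist_triangle (u := G.replaceEdges.src (G.newEdge e l))
      (v := G.oldVertex (G.src e))
      (w := G.replaceEdges.src (G.newEdge e' l'))
    have h5 := hG'.dist_triangle (u := G.oldVertex (G.src e)) (v := G.oldVertex (G.src e'))
      (w := G.replaceEdges.src (G.newEdge e' l'))
    have h6 := EdgeGraph.dist_inl_inl_le hG (G.src e) (G.src e')
    rw [SimpleGraph.dist_comm (u := G.oldVertex (G.src e))] at hs
    have h7 : (G.replaceEdges.toSimpleGraph.dist (G.replaceEdges.src (G.newEdge e l))
        (G.replaceEdges.src (G.newEdge e' l')) : ℝ) ≤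
        4 * G.toSimpleGraph.dist (G.src e) (G.src e') + (s + s') := by
      exact_mod_cast (by omega)
    have h8 := mul_le_mul_of_nonneg_left h7 (show (0 : ℝ) ≤ 4 ^ j by positivity)
    rw [pow_succ] at hα
    linarith
  · have h4 := hG'.dist_triangle (u := G.replaceEdges.tgt (G.newEdge e l))
      (v := G.oldVertex (G.tgt e))
      (w := G.replaceEdges.tgt (G.newEdge e' l'))
    have h5 := hG'.dist_triangle (u := G.oldVertex (G.tgt e)) (v := G.oldVertex (G.tgt e'))
      (w := G.replaceEdges.tgt (G.newEdge e' l'))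
    have h6 := EdgeGraph.dist_inl_inl_le hG (G.tgt e) (G.tgt e')
    rw [SimpleGraph.dist_comm (v := G.oldVertex (G.tgt e'))] at ht'
    have h7 : (G.replaceEdges.toSimpleGraph.dist (G.replaceEdges.tgt (G.newEdge e l))
        (G.replaceEdges.tgt (G.newEdge e' l')) : ℝ) ≤
        4 * G.toSimpleGraph.dist (G.tgt e) (G.tgt e') + (t + t') := by
      exact_mod_cast (by omega)
    have h8 := mul_le_mul_of_nonneg_left h7 (show (0 : ℝ) ≤ 4 ^ j by positivity)
    rw [pow_succ] at hβ
    linarith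
  · have h4 : (s : ℝ) + t = 3 := by exact_mod_cast hst
    have h5 : (s' : ℝ) + t' = 3 := by exact_mod_cast hst'
    rw [← hK, pow_succ]
    linear_combination (4 : ℝ) ^ j * h4 + (4 : ℝ) ^ j * h5
  · have h4 := abs_le.1 hsψ
    have h5 := abs_le.1 hsψ'
    linarith

end Drawing

end Drawing

/-! ### Lower bounds for distances in a drawing -/

namespace Drawing

variable {X : Type*} [NormedAddCommGroup X] [NormedSpace ℝ X]
variable {x : ℕ → X} {N j : ℕ} {G : EdgeGraph}

/-- Points on separated edges keep their distance up to the factor `c`. -/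
theorem Separated.le_norm {D : Drawing x N j G} {c : ℝ} (hc : 0 ≤ c)
    (hG : G.toSimpleGraph.Connected) {e e' : G.E} (h : D.Separated c e e') {a b : G.V}
    (ha : a = G.src e ∨ a = G.tgt e) (hb : b = G.src e' ∨ b = G.tgt e') :
    c * 4 ^ j * G.toSimpleGraph.dist a b ≤ ‖D.pos a - D.pos b‖ := by
  obtain ⟨ψ, hψ, u, u', h1, h2, h3⟩ := h
  have h4 := (h2.climb hc hb).neg
  rw [neg_neg] at h4
  have h5 : D.Climb c ψ b a := (h4.trans hc hG h3).trans hc hG (h1.climb hc ha)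
  rw [Climb, ← map_sub, SimpleGraph.dist_comm] at h5
  exact h5.trans ((le_abs_self _).trans ((ψ.le_of_opNorm_le hψ _).trans (by rw [one_mul])))

/-- Points on crossed edges keep almost half of their distance: the ways around through the
sources and through the targets have total length at most `K`, so the distance is at most `K / 2`,
while the functional sees almost `K / 4`. -/
theorem Crossed.le_norm {D : Drawing x N 0 G} {c : ℝ} (hc : 4 / 5 ≤ c) (hc1 : c ≤ 1)
    (hG : G.toSimpleGraph.Connected) {e e' : G.E} (h : D.Crossed c e e') {a b : G.V}
    (ha : a = G.src e ∨ a = G.tgt e) (hb : b = G.src e' ∨ b = G.tgt e') :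
    (5 * c - 4) / 2 * G.toSimpleGraph.dist a b ≤ ‖D.pos a - D.pos b‖ := by
  obtain ⟨ψ, hψ, h1, h2, α, β, K, hα, hβ, hK, h3⟩ := h
  have offset : ∀ (f : G.E) (d : G.V), (∀ i ∈ D.interval f, |ψ (x i)| ≤ 1 - c) →
      (d = G.src f ∨ d = G.tgt f) → ∃ s t : ℕ, s + t = 1 ∧ G.toSimpleGraph.dist (G.src f) d ≤ s ∧
        G.toSimpleGraph.dist d (G.tgt f) ≤ t ∧
        |ψ (D.pos d) - ψ (D.pos (G.src f))| ≤ (1 - c) * s := by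
    rintro f d hf (rfl | rfl)
    · exact ⟨0, 1, rfl, by simp, G.dist_src_tgt_le_one f, by simp⟩
    · refine ⟨1, 0, rfl, G.dist_src_tgt_le_one f, by simp, ?_⟩
      rw [D.pos_tgt, map_add, add_sub_cancel_left, pow_zero, one_smul, Nat.cast_one, mul_one]
      exact hf _ ⟨le_rfl, by simp⟩
  obtain ⟨s, t, hst, hs, ht, hψa⟩ := offset e a h1 ha
  obtain ⟨s', t', hst', hs', ht', hψb⟩ := offset e' b h2 hb
  rw [pow_zero, one_mul] at hα hβ
  have hst1 : (s : ℝ) + t = 1 := by exact_mod_cast hst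
  have hst1' : (s' : ℝ) + t' = 1 := by exact_mod_cast hst'
  have hd1 : (G.toSimpleGraph.dist a b : ℝ) ≤ α + s + s' := by
    have h4 := hG.dist_triangle (u := a) (v := G.src e) (w := b)
    have h5 := hG.dist_triangle (u := G.src e) (v := G.src e') (w := b)
    rw [SimpleGraph.dist_comm] at hs
    have h6 : (G.toSimpleGraph.dist a b : ℝ) ≤
        G.toSimpleGraph.dist (G.src e) (G.src e') + s + s' := by exact_mod_cast (by omega)
    linarith
  have hd2 : (G.toSimpleGraph.dist a b : ℝ) ≤ β + t + t' := by
    have h4 := hG.dist_triangle (u := a) (v := G.tgt e) (w := b)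
    have h5 := hG.dist_triangle (u := G.tgt e) (v := G.tgt e') (w := b)
    rw [SimpleGraph.dist_comm] at ht'
    have h6 : (G.toSimpleGraph.dist a b : ℝ) ≤
        G.toSimpleGraph.dist (G.tgt e) (G.tgt e') + t + t' := by exact_mod_cast (by omega)
    linarith
  -- the two routes, below and above, together have length at most `K`
  have hd : 2 * (G.toSimpleGraph.dist a b : ℝ) ≤ K := by linarith
  have hβ0 : 0 ≤ β := le_trans (Nat.cast_nonneg _) hβ
  have hψab : ψ (D.pos a) - ψ (D.pos b) ≤ ‖D.pos a - D.pos b‖ := by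
    rw [← map_sub]
    exact (le_abs_self _).trans ((ψ.le_of_opNorm_le hψ _).trans (by rw [one_mul]))
  have h4 := (abs_le.1 hψa).1
  have h5 := (abs_le.1 hψb).2
  have h6 : (1 - c) * (α + s + s') ≤ (1 - c) * K := by
    refine mul_le_mul_of_nonneg_left ?_ (by linarith)
    have : (0 : ℝ) ≤ t := Nat.cast_nonneg _
    have : (0 : ℝ) ≤ t' := Nat.cast_nonneg _
    linarith
  have h7 : (5 * c - 4) / 2 * G.toSimpleGraph.dist a b ≤ (5 * c - 4) / 4 * K := by
    have := mul_le_mul_of_nonneg_left hd (show 0 ≤ (5 * c - 4) / 4 by linarith)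
    linarith
  linarith

/-- Functionals of norm at most one that are almost one on the first `k` of `N` vectors and
almost minus one on the others. -/
def HasSigns (x : ℕ → X) (N : ℕ) (c : ℝ) : Prop :=
  ∀ k ≤ N, ∃ ψ : StrongDual ℝ X, ‖ψ‖ ≤ 1 ∧ (∀ i < k, i < N → c ≤ ψ (x i)) ∧
    ∀ i, k ≤ i → i < N → ψ (x i) ≤ -c

/-- The edges that replace a single edge are pairwise separated or crossed. -/
theorem separated_or_crossed_newEdges {c : ℝ} (hc : 0 ≤ c) (hx : ∀ i, ‖x i‖ ≤ 1)
    (hs : HasSigns x N c) (hG : G.toSimpleGraph.Connected) (D : Drawing x N (j + 1) G) (e : G.E)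
    {l l' : LaaksoEdge} (hl : l ≠ l') :
    D.refine.Separated c (G.newEdge e l) (G.newEdge e l') ∨
      D.refine.Crossed c (G.newEdge e l) (G.newEdge e l') ∨
      D.refine.Crossed c (G.newEdge e l') (G.newEdge e l) := by
  have hG' := G.replaceEdges_connected hG
  have hlbl := D.lbl_le e
  rw [pow_succ] at hlbl
  obtain ⟨φ, hφ, hφ1, -⟩ := hs N le_rfl
  obtain ⟨ψ, hψ, hψ1, hψ2⟩ := hs (D.lbl e + 2 ^ j) (by omega)
  have hφI : ∀ l, ∀ i ∈ D.refine.interval (G.newEdge e l), c ≤ φ (x i) := by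
    intro l i hi
    have h1 := (D.interval_refine_subset e l hi).2
    have h2 := D.lbl_le e
    exact hφ1 i (by omega) (by omega)
  have hclimb : ∀ l, D.refine.Climb c φ (G.replaceEdges.src (G.newEdge e l))
      (G.replaceEdges.tgt (G.newEdge e l)) := fun l => climb_src_tgt hc (hφI l)
  -- an edge below another one
  have below : ∀ l l', D.refine.Climb c φ (G.replaceEdges.tgt (G.newEdge e l))
      (G.replaceEdges.src (G.newEdge e l')) →
      D.refine.Separated c (G.newEdge e l) (G.newEdge e l') := by
    intro l l' h
    refine Separated.symm ⟨φ, hφ, _, _, Or.inl ⟨rfl, hφI l'⟩, Or.inr ⟨rfl, fun i hi => ?_⟩, h⟩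
    rw [neg_apply]
    exact neg_le_neg (hφI l i hi)
  have hYC : D.refine.Separated c (G.newEdge e .Y) (G.newEdge e .C) :=
    below _ _ (Climb.refl _ _ _ _)
  have hYD : D.refine.Separated c (G.newEdge e .Y) (G.newEdge e .D) :=
    below _ _ (Climb.refl _ _ _ _)
  have hYE : D.refine.Separated c (G.newEdge e .Y) (G.newEdge e .E) := below _ _ (hclimb .C)
  have hYF : D.refine.Separated c (G.newEdge e .Y) (G.newEdge e .F) := below _ _ (hclimb .D)
  have hYZ : D.refine.Separated c (G.newEdge e .Y) (G.newEdge e .Z) :=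
    below _ _ ((hclimb .C).trans hc hG' (hclimb .E))
  have hCE : D.refine.Separated c (G.newEdge e .C) (G.newEdge e .E) :=
    below _ _ (Climb.refl _ _ _ _)
  have hDF : D.refine.Separated c (G.newEdge e .D) (G.newEdge e .F) :=
    below _ _ (Climb.refl _ _ _ _)
  have hCZ : D.refine.Separated c (G.newEdge e .C) (G.newEdge e .Z) := below _ _ (hclimb .E)
  have hDZ : D.refine.Separated c (G.newEdge e .D) (G.newEdge e .Z) := below _ _ (hclimb .F)
  have hEZ : D.refine.Separated c (G.newEdge e .E) (G.newEdge e .Z) :=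
    below _ _ (Climb.refl _ _ _ _)
  have hFZ : D.refine.Separated c (G.newEdge e .F) (G.newEdge e .Z) :=
    below _ _ (Climb.refl _ _ _ _)
  -- the functional `ψ` distinguishes the two halves of the interval of `e`
  have hψ1' : ∀ i ∈ Set.Ico (D.lbl e) (D.lbl e + 2 ^ j), c ≤ ψ (x i) := fun i hi =>
    hψ1 i hi.2 (by have := hi.2; omega)
  have hψ2' : ∀ i ∈ Set.Ico (D.lbl e + 2 ^ j) (D.lbl e + 2 ^ j + 2 ^ j), ψ (x i) ≤ -c :=
    fun i hi => hψ2 i hi.1 (by have := hi.2; omega)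
  have hCD : D.refine.Separated c (G.newEdge e .C) (G.newEdge e .D) := by
    refine ⟨ψ, hψ, _, _, Or.inl ⟨rfl, hψ1'⟩, Or.inl ⟨rfl, fun i hi => ?_⟩, Climb.refl _ _ _ _⟩
    rw [neg_apply]
    linarith [hψ2' i hi]
  have hEF : D.refine.Separated c (G.newEdge e .E) (G.newEdge e .F) := by
    refine ⟨ψ, hψ, _, _, Or.inr ⟨rfl, hψ2'⟩, Or.inr ⟨rfl, fun i hi => ?_⟩, Climb.refl _ _ _ _⟩
    rw [neg_apply]
    linarith [hψ1' i hi]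
  have hone : ∀ θ : StrongDual ℝ X, ‖θ‖ ≤ 1 → ∀ i, |θ (x i)| ≤ 1 := fun θ hθ i =>
    (θ.le_of_opNorm_le hθ _).trans (by rw [one_mul]; exact hx i)
  -- the edges `f` and `f'` both use the half of the interval that `g`, below `f`, does not use
  have cross : ∀ f f' g, ∀ θ : StrongDual ℝ X, ‖θ‖ ≤ 1 →
      (∀ i ∈ D.refine.interval (G.newEdge e f), θ (x i) ≤ -c) →
      (∀ i ∈ D.refine.interval (G.newEdge e f'), θ (x i) ≤ -c) →
      (∀ i ∈ D.refine.interval (G.newEdge e g), c ≤ θ (x i)) →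
      G.replaceEdges.src (G.newEdge e g) = G.replaceEdges.src (G.newEdge e f') →
      G.replaceEdges.tgt (G.newEdge e g) = G.replaceEdges.src (G.newEdge e f) →
      G.replaceEdges.toSimpleGraph.dist (G.replaceEdges.tgt (G.newEdge e f))
        (G.replaceEdges.tgt (G.newEdge e f')) ≤ 1 →
      D.refine.Crossed c (G.newEdge e f) (G.newEdge e f') := by
    intro f f' g θ hθ h1 h2 h3 h4 h5 h6
    have hsmall : ∀ i, c ≤ φ (x i) → θ (x i) ≤ -c → |((1 / 2 : ℝ) • (φ + θ)) (x i)| ≤ 1 - c := by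
      intro i hi1 hi2
      have h7 := abs_le.1 (hone φ hφ i)
      have h8 := abs_le.1 (hone θ hθ i)
      have h9 : ((1 / 2 : ℝ) • (φ + θ)) (x i) = (φ (x i) + θ (x i)) / 2 := by
        simp; ring
      rw [h9, abs_le]
      constructor <;> linarith
    refine ⟨(1 / 2 : ℝ) • (φ + θ), ?_, fun i hi => hsmall i (hφI f i hi) (h1 i hi),
      fun i hi => hsmall i (hφI f' i hi) (h2 i hi), 4 ^ j, 4 ^ j, 4 * 4 ^ j, ?_, ?_, by ring, ?_⟩
    · rw [norm_smul]
      have := norm_add_le φ θ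
      norm_num
      linarith
    · rw [← h4, ← h5, SimpleGraph.dist_comm]
      have h7 : (G.replaceEdges.toSimpleGraph.dist (G.replaceEdges.src (G.newEdge e g))
        (G.replaceEdges.tgt (G.newEdge e g)) : ℝ) ≤ 1 := by
        exact_mod_cast G.replaceEdges.dist_src_tgt_le_one _
      exact mul_le_of_le_one_right (by positivity) h7
    · exact mul_le_of_le_one_right (by positivity) (by exact_mod_cast h6)
    · rw [← h4, ← h5, D.refine.pos_tgt, map_add, map_smul, add_sub_cancel_left, smul_eq_mul]
      have h7 : c ≤ ((1 / 2 : ℝ) • (φ + θ))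
          (dyadicAverage x j (D.refine.lbl (G.newEdge e g))) := by
        refine le_apply_dyadicAverage fun i hi => ?_
        have h8 := hφI g i hi
        have h9 := h3 i hi
        simp only [smul_apply, add_apply, smul_eq_mul]
        linarith
      have h8 := mul_le_mul_of_nonneg_left h7 (show (0 : ℝ) ≤ 4 ^ j by positivity)
      have hc1 : c ≤ 1 := (hφI .Y (D.lbl e) ⟨le_rfl, Nat.lt_add_of_pos_right (by positivity)⟩).trans
        ((le_abs_self _).trans (hone φ hφ _))
      have h9 := mul_nonneg (sub_nonneg.2 hc1) (show (0 : ℝ) ≤ 4 ^ j by positivity)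
      linarith
  have hED : D.refine.Crossed c (G.newEdge e .E) (G.newEdge e .D) :=
    cross .E .D .C ψ hψ hψ2' hψ2' hψ1' rfl rfl (by
      rw [SimpleGraph.dist_comm]; exact G.replaceEdges.dist_src_tgt_le_one (G.newEdge e .F))
  have hFC : D.refine.Crossed c (G.newEdge e .F) (G.newEdge e .C) := by
    have hneg1 : ∀ i ∈ Set.Ico (D.lbl e) (D.lbl e + 2 ^ j), (-ψ) (x i) ≤ -c := fun i hi => by
      rw [neg_apply]; exact neg_le_neg (hψ1' i hi)
    refine cross .F .C .D (-ψ) (by rwa [norm_neg]) hneg1 hneg1 (fun i hi => ?_) rfl rfl (by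
      rw [SimpleGraph.dist_comm]; exact G.replaceEdges.dist_src_tgt_le_one (G.newEdge e .E))
    rw [neg_apply]
    linarith [hψ2' i hi]
  cases l <;> cases l' <;> first
    | exact absurd rfl hl
    | exact Or.inl (by assumption)
    | exact Or.inl (Separated.symm (by assumption))
    | exact Or.inr (Or.inl (by assumption))
    | exact Or.inr (Or.inr (by assumption))

/-- Any two different edges of the drawing are separated or crossed. -/
def IsSpread (D : Drawing x N j G) (c : ℝ) : Prop :=
  ∀ e e', e ≠ e' → D.Separated c e e' ∨ D.Crossed c e e' ∨ D.Crossed c e' e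

theorem IsSpread.refine {c : ℝ} (hc : 0 ≤ c) (hx : ∀ i, ‖x i‖ ≤ 1) (hs : HasSigns x N c)
    (hG : G.toSimpleGraph.Connected) {D : Drawing x N (j + 1) G} (h : D.IsSpread c) :
    D.refine.IsSpread c := by
  rintro ⟨e, l⟩ ⟨e', l'⟩ hne
  by_cases he : e = e'
  · subst he
    exact separated_or_crossed_newEdges hc hx hs hG D e fun hl => hne (by rw [hl])
  · rcases h e e' he with h1 | h1 | h1
    · exact Or.inl (h1.refine hc hG l l')
    · exact Or.inr (Or.inl (h1.refine hG l l'))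
    · exact Or.inr (Or.inr (h1.refine hG l' l))

/-- The Laakso graph of level `m` has a spread drawing with edges of length `4 ^ j`. -/
theorem exists_isSpread {c : ℝ} (hc : 0 ≤ c) (hx : ∀ i, ‖x i‖ ≤ 1) {n : ℕ}
    (hs : HasSigns x (2 ^ n) c) (m j : ℕ) (hmj : m + j = n) :
    ∃ D : Drawing x (2 ^ n) j (laaksoEdgeGraph m), D.IsSpread c := by
  induction m generalizing j with
  | zero =>
    obtain rfl : j = n := by omega
    let D : Drawing x (2 ^ j) j (laaksoEdgeGraph 0) :=
      { pos := fun b => match b with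
          | false => 0
          | true => (4 : ℝ) ^ j • dyadicAverage x j 0
        lbl := fun _ => 0
        pos_tgt := fun _ => (zero_add _).symm
        lbl_le := fun _ => by simp }
    exact ⟨D, fun e e' h => absurd (Subsingleton.elim (α := Unit) e e') h⟩
  | succ m ih =>
    obtain ⟨D, hD⟩ := ih (j + 1) (by omega)
    exact ⟨D.refine, hD.refine hc hx hs (laaksoGraph_connected m)⟩

theorem norm_sub_le_dist (hx : ∀ i, ‖x i‖ ≤ 1) (hG : G.toSimpleGraph.Connected)
    (D : Drawing x N 0 G) (a b : G.V) : ‖D.pos a - D.pos b‖ ≤ G.toSimpleGraph.dist a b := by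
  have hedge : ∀ e, ‖D.pos (G.tgt e) - D.pos (G.src e)‖ ≤ 1 := by
    intro e
    rw [D.pos_tgt, add_sub_cancel_left, pow_zero, one_smul]
    exact hx _
  obtain ⟨p, hp⟩ := hG.exists_walk_length_eq_dist a b
  rw [← hp]
  clear hp
  induction p with
  | nil => simp
  | @cons a b c h p ih =>
    have h1 : ‖D.pos a - D.pos b‖ ≤ 1 := by
      obtain ⟨-, ⟨e, rfl, rfl⟩ | ⟨e, rfl, rfl⟩⟩ := (SimpleGraph.fromRel_adj _ _ _).1 h
      · rw [norm_sub_rev]; exact hedge e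
      · exact hedge e
    have h2 := norm_sub_le_norm_sub_add_norm_sub (D.pos a) (D.pos b) (D.pos c)
    rw [SimpleGraph.Walk.length_cons]
    push_cast
    linarith

theorem IsSpread.le_norm {D : Drawing x N 0 G} {c : ℝ} (hc : 4 / 5 ≤ c) (hc1 : c ≤ 1)
    (hs : HasSigns x N c) (hG : G.toSimpleGraph.Connected) (hD : D.IsSpread c)
    (hcover : ∀ a, ∃ e, a = G.src e ∨ a = G.tgt e) (a b : G.V) :
    (5 * c - 4) / 2 * G.toSimpleGraph.dist a b ≤ ‖D.pos a - D.pos b‖ := by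
  have hc0 : 0 ≤ c := by linarith
  obtain ⟨e, he⟩ := hcover a
  obtain ⟨e', he'⟩ := hcover b
  have hweak : ∀ a b, c * 4 ^ 0 * (G.toSimpleGraph.dist a b : ℝ) ≤ ‖D.pos a - D.pos b‖ →
      (5 * c - 4) / 2 * G.toSimpleGraph.dist a b ≤ ‖D.pos a - D.pos b‖ := by
    intro a b h
    refine le_trans ?_ h
    gcongr
    linarith
  by_cases hee : e = e'
  · subst hee
    obtain ⟨φ, hφ, hφ1, -⟩ := hs N le_rfl
    have h1 : D.Climb c φ (G.src e) (G.tgt e) := climb_src_tgt hc0 fun i hi => by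
      have h2 := hi.2
      have h3 := D.lbl_le e
      exact hφ1 i (by omega) (by omega)
    have h2 : c * 4 ^ 0 * (G.toSimpleGraph.dist (G.src e) (G.tgt e) : ℝ) ≤
        ‖D.pos (G.tgt e) - D.pos (G.src e)‖ := by
      rw [Climb, ← map_sub] at h1
      exact h1.trans ((le_abs_self _).trans ((φ.le_of_opNorm_le hφ _).trans (by rw [one_mul])))
    rcases he with rfl | rfl <;> rcases he' with rfl | rfl
    · simp
    · rw [norm_sub_rev] at h2; exact hweak _ _ h2
    · rw [SimpleGraph.dist_comm] at h2; exact hweak _ _ h2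
    · simp
  · rcases hD e e' hee with h | h | h
    · exact hweak a b (h.le_norm hc0 hG he he')
    · exact h.le_norm hc hc1 hG he he'
    · rw [SimpleGraph.dist_comm, norm_sub_rev]
      exact h.le_norm hc hc1 hG he' he

end Drawing

/-! ### Finiteness of the Laakso graphs -/

theorem exists_eq_src_or_eq_tgt_laakso (n : ℕ) (a : (laaksoEdgeGraph n).V) :
    ∃ e, a = (laaksoEdgeGraph n).src e ∨ a = (laaksoEdgeGraph n).tgt e := by
  induction n with
  | zero =>
    cases a with
    | false => exact ⟨(), Or.inl rfl⟩
    | true => exact ⟨(), Or.inr rfl⟩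
  | succ n ih =>
    rcases a with a | ⟨e, _ | _ | _ | _⟩
    · obtain ⟨e, rfl | rfl⟩ := ih a
      · exact ⟨(e, .Y), Or.inl rfl⟩
      · exact ⟨(e, .Z), Or.inr rfl⟩
    · exact ⟨(e, .Y), Or.inr rfl⟩
    · exact ⟨(e, .C), Or.inr rfl⟩
    · exact ⟨(e, .D), Or.inr rfl⟩
    · exact ⟨(e, .E), Or.inr rfl⟩

theorem finite_laaksoEdgeGraph (n : ℕ) :
    Finite (laaksoEdgeGraph n).V ∧ Finite (laaksoEdgeGraph n).E := by
  have h1 : Finite LaaksoInner := Set.finite_univ_iff.1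
    ((Set.toFinite {.T, .L, .R, .B}).subset fun i _ => by cases i <;> simp)
  have h2 : Finite LaaksoEdge := Set.finite_univ_iff.1
    ((Set.toFinite {.Y, .C, .D, .E, .F, .Z}).subset fun i _ => by cases i <;> simp)
  induction n with
  | zero => exact ⟨inferInstanceAs (Finite Bool), inferInstanceAs (Finite Unit)⟩
  | succ n ih =>
    obtain ⟨_, _⟩ := ih
    exact ⟨inferInstanceAs (Finite ((laaksoEdgeGraph n).V ⊕ ((laaksoEdgeGraph n).E × LaaksoInner))),
      inferInstanceAs (Finite ((laaksoEdgeGraph n).E × LaaksoEdge))⟩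

theorem exists_dist_laakso_le (n : ℕ) : ∃ M : ℝ, 0 ≤ M ∧ ∀ a b : Laakso n, dist a b ≤ M := by
  have : Finite (Laakso n) := (finite_laaksoEdgeGraph n).1
  obtain ⟨M, hM⟩ := (Set.finite_range fun p : Laakso n × Laakso n => dist p.1 p.2).bddAbove
  exact ⟨max M 0, le_max_right _ _, fun a b => (hM ⟨(a, b), rfl⟩).trans (le_max_left _ _)⟩

/-! ### Embedding the Laakso graphs -/

/-- A space that is not super-reflexive contains images of the Laakso graph under maps that do not
increase distances and keep at least the fraction `(1 - 5 * τ) / 2` of every distance. -/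
theorem exists_laakso_embedding (𝕜 : Type w) [RCLike 𝕜] (X : Type u) [NormedAddCommGroup X]
    [NormedSpace 𝕜 X] (hX : ¬ IsSuperReflexive.{u, v, w} 𝕜 X) (n : ℕ) {τ : ℝ} (hτ : 0 < τ)
    (hτ1 : 5 * τ ≤ 1) :
    ∃ f : Laakso n → X, ∀ a b : Laakso n,
      (1 - 5 * τ) / 2 * dist a b ≤ ‖f a - f b‖ ∧ ‖f a - f b‖ ≤ dist a b := by
  let _ : NormedSpace ℝ X := NormedSpace.restrictScalars ℝ 𝕜 X
  obtain ⟨x, hx, hflat⟩ := exists_flat_sequence_of_not_superReflexive 𝕜 X hX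
    (N := 2 ^ n) (by positivity) (δ := τ / (2 ^ n : ℕ)) (by positivity)
  have hs : Drawing.HasSigns x (2 ^ n) (1 - τ) := by
    intro k hk
    have h := exists_dual_of_flat hx (by positivity) (hflat k hk)
    rwa [mul_div_cancel₀ _ (by positivity)] at h
  have hG := laaksoGraph_connected n
  obtain ⟨D, hD⟩ := Drawing.exists_isSpread (by linarith) hx hs n 0 rfl
  refine ⟨D.pos, fun a b => ⟨?_, Drawing.norm_sub_le_dist hx hG D a b⟩⟩
  have h := hD.le_norm (by linarith) (by linarith) hs hG (exists_eq_src_or_eq_tgt_laakso n) a b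
  rwa [show 5 * (1 - τ) - 4 = 1 - 5 * τ by ring] at h

theorem mainTheorem1 (𝕜 : Type w) [RCLike 𝕜]
    (X : Type u) [NormedAddCommGroup X] [NormedSpace 𝕜 X] [CompleteSpace X]
    (hX : ¬ IsSuperReflexive.{u, v, w} 𝕜 X) (n : ℕ) (hn : 1 ≤ n) (ε : ℝ) (hε : 0 < ε) :
    ∃ f : Laakso n → X,
      (∀ a b : Laakso n,
        (1 / 2 : ℝ) * dist a b - ε ≤ ‖f a - f b‖ ∧ ‖f a - f b‖ ≤ dist a b) ∧
      IsBilipschitz f ∧ distortion f < 2 + ε := by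
  obtain ⟨M, hM0, hM⟩ := exists_dist_laakso_le n
  -- `τ` is small enough for the additive error on the diameter and for the distortion
  obtain ⟨τ, hτ, hτM, hτε⟩ : ∃ τ > 0, 5 * τ * M ≤ ε ∧ 5 * τ * (2 + ε) < ε := by
    refine ⟨ε / (10 * (M + 1) * (2 + ε)), by positivity, ?_, ?_⟩
    · rw [mul_div_assoc', div_mul_eq_mul_div, div_le_iff₀ (by positivity)]
      nlinarith [mul_nonneg hε.le hM0, mul_nonneg (mul_nonneg hε.le hM0) hε.le, mul_pos hε hε]
    · rw [mul_div_assoc', div_mul_eq_mul_div, div_lt_iff₀ (by positivity)]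
      nlinarith [mul_nonneg hε.le hM0, mul_nonneg (mul_nonneg hε.le hM0) hε.le, mul_pos hε hε]
  have hτ1 : 5 * τ < 1 := by
    by_contra h
    nlinarith
  obtain ⟨f, hf⟩ := exists_laakso_embedding 𝕜 X hX n hτ hτ1.le
  have hmem : 1 / ((1 - 5 * τ) / 2) ∈ distortionRatios f := by
    refine ⟨(1 - 5 * τ) / 2, 1, by linarith, one_pos, rfl, fun a b => ?_⟩
    rw [dist_eq_norm, one_mul]
    exact hf a b
  refine ⟨f, fun a b => ⟨le_trans ?_ (hf a b).1, (hf a b).2⟩, ⟨_, hmem⟩, ?_⟩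
  · have h1 := mul_le_mul_of_nonneg_left (hM a b) (show 0 ≤ 5 * τ by positivity)
    linarith
  · have hbdd : BddBelow (distortionRatios f) := by
      refine ⟨0, ?_⟩
      rintro r ⟨α, β, hα, hβ, rfl, -⟩
      positivity
    refine (csInf_le hbdd hmem).trans_lt ?_
    rw [div_lt_iff₀ (by linarith)]
    linarith
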